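/- **Setting.** Fix $T,N\ge 1$ and dimensions $n_{\rm in},n_u,n_y$. For sequences $\mathbf u=(\mathbf u[1],\dots,\mathbf u[T])$ in $\mathbb R^n$ put $\|\mathbf u\|_{\ell^2_T}=(\sum_k\|\mathbf u[k]\|_2^2)^{1/2}$. $\|W\|_{p,p}$ is the operator norm of a matrix with respect to $\|\cdot\|_p$, $p\in\{2,\infty\}$. An *SSM* $\Sigma=(A,B,C,D)$ (any state dimension) is $\mathbf x[k+1]=A\mathbf x[k]+B\mathbf u[k]$, $\mathbf x[1]=0$, $\mathbf y[k]=C\mathbf x[k]+D\mathbf u[k]$, with input-output map $\mathcal S_\Sigma$ from sequences in $\mathbb R^{n_u}$ to sequences in $\mathbb R^{n_y}$; it is *stable* if all eigenvalues of $A$ lie in the open unit disk. Put $\|\Sigma\|_1=\max_i[\|D_i\|_1+\sum_{k\ge0}\|C_iA^kB\|_1]$ and $\|\Sigma\|_2=(\|D\|_F^2+\sum_{k\ge0}\|CA^kB\|_F^2)^{1/2}$. A *sigmoid* is a $1$-Lipschitz $\rho:\mathbb R\to[-1,1]$ with $\rho(0)=\tfrac12$ and $\rho-\rho(0)$ odd.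 An *MLP* with $M\ge1$ hidden layers and activation $\rho$ is $g_{M+1}\circ(\rho\circ g_M)\circ\dots\circ(\rho\circ g_1)$ with $g_j(\mathbf x)=W_j\mathbf x+\mathbf b_j$, $\rho$ applied entrywise. A *GLU* (for $n_y=n_u$) is $\mathbf v\mapsto \mathrm{GELU}(\mathbf v)\odot\sigma(W\,\mathrm{GELU}(\mathbf v))$ with $\sigma$ a sigmoid and $\mathrm{GELU}(x)=x\Phi(x)$, where $\Phi$ is the standard normal distribution function. A *deep SSM model* of depth $L\ge1$ is the function $f(\mathbf u)=W_{\rm Dec}\cdot\frac1T\sum_{k=1}^T(B_L\circ\dots\circ B_1)(W_{\rm Enc}\mathbf u)[k]$, where $W_{\rm Enc}$ acts at each time step and $B_i(\mathbf v)[k]=g_i(\mathcal S_{\Sigma_i}(\mathbf v)[k])+\alpha_i\mathbf v[k]$ with $g_i:\mathbb R^{n_y}\to\mathbb R^{n_u}$ an MLP or a GLU. **Assumptions.** $\mathcal F$ is a family of deep SSM models of depth $L$ with scalar output and common residual weights $\alpha_1,\dots,\alpha_L\in\mathbb R$. There are constants such that for every model in $\mathcal F$: $\|W_{\rm Enc}\|_{2,2}<K_{\rm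 Enc}$ and $\|W_{\rm Dec}\|_{\infty,\infty}<K_{\rm Dec}$; each $\Sigma_i$ is stable with $\|\Sigma_i\|_1\le K_1$, $\|\Sigma_i\|_2\le K_2$; and for each $i$ (with the type, $M_i$ and activation common to all models) $g_i$ is either a ReLU MLP or a sigmoid MLP with $M_i$ hidden layers and $\|W_j\|_{\infty,\infty}<K_{W,i}$, $\|\mathbf b_j\|_\infty<K_{\mathbf b,i}$ for all $j\le M_i+1$, or a GLU with $\|W\|_{\infty,\infty}<K_{{\rm GLU},i}$. The loss $\ell:\mathbb R\times\mathbb R\to[0,\infty)$ satisfies $\ell(y,y')=0$ iff $y=y'$, and $\ell(y_1,y_1')-\ell(y_2,y_2')\le L_\ell(|y_1-y_2|+|y_1'-y_2'|)$. $\mathcal D$ is a probability measure on pairs (sequence $\mathbf u$ of length $T$ in $\mathbb R^{n_{\rm in}}$, label $y\in\mathbb R$) with $\|\mathbf u\|_{\ell^2_T}\le K_{\mathbf u}$ and $|y|\le K_y$ almost surely, where $K_{\mathbf u},K_y>0$. Let $\mathcal L(f)=\mathbf E_{(\mathbf u,y)\sim\mathcal D}\,\ell(f(\mathbf u),y)$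 and, for a sample $S=\{(\mathbf u_i,y_i)\}_{i=1}^N$, $\mathcal L^S_{emp}(f)=\frac1N\sum_{i=1}^N\ell(f(\mathbf u_i),y_i)$. **Constants.** For the nonlinear layer $i$ let - ReLU MLP: $\mu_i(r)=(4K_{W,i})^{M_i+1}$, $c_i=4K_{\mathbf b,i}\sum_{q=0}^{M_i}(4K_{W,i})^q$, $\hat r_i(r)=K_{W,i}^{M_i+1}r+K_{\mathbf b,i}\sum_{q=0}^{M_i}K_{W,i}^q$; - sigmoid MLP: $\mu_i(r)=K_{W,i}^{M_i+1}$, $c_i=(K_{\mathbf b,i}+\tfrac12)\sum_{q=0}^{M_i}K_{W,i}^q$, $\hat r_i(r)=K_{W,i}+K_{\mathbf b,i}$; - GLU: $\mu_i(r)=16(rz^2+z)$ with $z=K_{{\rm GLU},i}+1$, $c_i=0$, $\hat r_i(r)=r$. Put $\kappa_1=K_2$ and $\kappa_i=K_1$ for $i\ge2$; $r_1=K_{\rm Enc}K_{\mathbf u}$ and $r_{i+1}=\hat r_i(\kappa_ir_i)+|\alpha_i|r_i$ for $1\le i\le L$; $\mu_i=\mu_i(\kappa_ir_i)$; and $$\mu=K_{\rm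 Enc}K_{\rm Dec}\prod_{i=1}^L(\mu_i\kappa_i+|\alpha_i|),\quad c=K_{\rm Dec}\sum_{j=1}^L\Big[\prod_{i=j+1}^L(\mu_i\kappa_i+|\alpha_i|)\Big]c_j,\quad K_l=2L_\ell\max\{K_{\rm Dec}r_{L+1},K_y\}.$$ **Theorem.** Under these assumptions, for every $\delta\in(0,1)$, $$\mathbf P_{S\sim\mathcal D^N}\Big(\forall f\in\mathcal F:\ \mathcal L(f)-\mathcal L^S_{emp}(f)\le\frac{2(\mu K_{\mathbf u}L_\ell+cL_\ell)}{\sqrt N}+K_l\sqrt{\frac{2\log(4/\delta)}{N}}\Big)>1-\delta$$ (the event being measurable). The constants $\mu,c,K_l$ do not depend on $T$. -/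

import Mathlib

open MeasureTheory ProbabilityTheory

noncomputable section

/-- Sequences of length `T` over `ℝⁿ`; the time index `k = 1, …, T` is shifted to `0, …, T - 1`. -/
abbrev TSeq (T n : ℕ) : Type := Fin T → Fin n → ℝ

/-- The Euclidean norm of a sequence, viewed as a vector of `ℝ^(nT)`. -/
def TSeq.l2Norm {T n : ℕ} (u : TSeq T n) : ℝ := √(∑ k, ∑ j, u k j ^ 2)

/-! ### Matrix norms -/

/-- The operator norm `‖W‖_{2,2}` of `W : (ℝⁿ, ‖·‖₂) → (ℝᵐ, ‖·‖₂)`. -/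
def opNormTwo {m n : ℕ} (W : Matrix (Fin m) (Fin n) ℝ) : ℝ :=
  ‖LinearMap.toContinuousLinearMap (Matrix.toLpLin 2 2 W)‖

/-- The operator norm `‖W‖_{∞,∞}` of `W : (ℝⁿ, ‖·‖_∞) → (ℝᵐ, ‖·‖_∞)`
(function spaces `Fin n → ℝ` carry the supremum norm). -/
def opNormInf {m n : ℕ} (W : Matrix (Fin m) (Fin n) ℝ) : ℝ :=
  ‖LinearMap.toContinuousLinearMap (Matrix.toLin' W)‖

/-! ### State-space models -/

/-- A discrete-time linear state-space model `x[k+1] = A x[k] + B u[k]`, `x[1] = 0`,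
`y[k] = C x[k] + D u[k]`, with state dimension `nx`, `nu` inputs and `ny` outputs. -/
structure SSM (nu ny : ℕ) where
  nx : ℕ
  A : Matrix (Fin nx) (Fin nx) ℝ
  B : Matrix (Fin nx) (Fin nu) ℝ
  C : Matrix (Fin ny) (Fin nx) ℝ
  D : Matrix (Fin ny) (Fin nu) ℝ

namespace SSM

variable {nu ny : ℕ}

/-- The state trajectory driven by the input `u`. -/
def state (s : SSM nu ny) {T : ℕ} (u : TSeq T nu) : ℕ → Fin s.nx → ℝ
  | 0 => 0
  | k + 1 => s.A.mulVec (s.state u k) + s.B.mulVec (if h : k < T then u ⟨k, h⟩ else 0)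

/-- The input-output map of the model on sequences of length `T`. -/
def ioMap (s : SSM nu ny) {T : ℕ} (u : TSeq T nu) : TSeq T ny :=
  fun k => s.C.mulVec (s.state u k) + s.D.mulVec (u k)

/-- Internal stability: all complex eigenvalues of `A` lie in the open unit disk. -/
def IsStable (s : SSM nu ny) : Prop :=
  ∀ z ∈ spectrum ℂ (s.A.map (algebraMap ℝ ℂ)), ‖z‖ < 1

/-- The `ℓ₁` norm `max_i (‖D_i‖₁ + ∑_{k ≥ 0} ‖C_i A^k B‖₁)`, as an extended real
(it is finite for stable models). -/
def l1Norm (s : SSM nu ny) : ENNReal :=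
  ⨆ i : Fin ny, (ENNReal.ofReal (∑ j, |s.D i j|)
    + ∑' k : ℕ, ENNReal.ofReal (∑ j, |(s.C * s.A ^ k * s.B) i j|))

/-- The `H₂` norm `(‖D‖_F² + ∑_{k ≥ 0} ‖C A^k B‖_F²)^{1/2}`, as an extended real
(it is finite for stable models). -/
def h2Norm (s : SSM nu ny) : ENNReal :=
  (ENNReal.ofReal (∑ i, ∑ j, s.D i j ^ 2)
    + ∑' k : ℕ, ENNReal.ofReal (∑ i, ∑ j, (s.C * s.A ^ k * s.B) i j ^ 2)) ^ (1 / 2 : ℝ)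

end SSM

/-! ### Nonlinear layers -/

/-- The rectified linear unit. -/
def relu (x : ℝ) : ℝ := max x 0

/-- The Gaussian error linear unit `x ↦ x Φ(x)`, `Φ` the standard normal distribution function. -/
def gelu (x : ℝ) : ℝ := x * (gaussianReal 0 1).real (Set.Iic x)

/-- The sigmoid functions that are admitted: `ρ(0) = 1/2`, `ρ` is `1`-Lipschitz with values in
`[-1, 1]`, and `ρ - ρ(0)` is odd. The logistic function is one of them. -/
structure IsSigmoid (ρ : ℝ → ℝ) : Prop where
  zero : ρ 0 = 1 / 2
  lipschitz : LipschitzWith 1 ρ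
  mem_Icc : ∀ x, ρ x ∈ Set.Icc (-1 : ℝ) 1
  odd : ∀ x, ρ (-x) - ρ 0 = -(ρ x - ρ 0)

/-- Weights and biases of a multilayer perceptron with `M` hidden layers (of arbitrary widths),
so with `M + 1` affine maps, from `ℝⁱ` to `ℝᵒ`. -/
inductive MLPWeights : ℕ → ℕ → ℕ → Type
  | output {i o : ℕ} (W : Matrix (Fin o) (Fin i) ℝ) (b : Fin o → ℝ) : MLPWeights 0 i o
  | hidden {M i h o : ℕ} (W : Matrix (Fin h) (Fin i) ℝ) (b : Fin h → ℝ)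
      (rest : MLPWeights M h o) : MLPWeights (M + 1) i o

namespace MLPWeights

/-- The network function: `ρ` (entrywise) after every affine map but the last. -/
def eval (ρ : ℝ → ℝ) : {M i o : ℕ} → MLPWeights M i o → (Fin i → ℝ) → Fin o → ℝ
  | _, _, _, output W b, x => W.mulVec x + b
  | _, _, _, hidden W b rest, x => rest.eval ρ (fun j => ρ ((W.mulVec x + b) j))

/-- All weight matrices satisfy `‖W‖_{∞,∞} < KW` and all biases satisfy `‖b‖_∞ < Kb`. -/
def Bounded (KW Kb : ℝ) : {M i o : ℕ} → MLPWeights M i o → Prop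
  | _, _, _, output W b => opNormInf W < KW ∧ ‖b‖ < Kb
  | _, _, _, hidden W b rest => (opNormInf W < KW ∧ ‖b‖ < Kb) ∧ rest.Bounded KW Kb

end MLPWeights

/-- A nonlinear layer: an MLP with activation `ρ`, or a GLU layer
`v ↦ GELU(v) ⊙ σ(W GELU(v))`, which exists only if input and output dimension agree. -/
inductive NonlinearLayer (ny nu : ℕ) : Type
  | mlp (ρ : ℝ → ℝ) (M : ℕ) (w : MLPWeights M ny nu) : NonlinearLayer ny nu
  | glu (h : ny = nu) (σ : ℝ → ℝ) (W : Matrix (Fin nu) (Fin ny) ℝ) : NonlinearLayer ny nu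

/-- The function of a nonlinear layer at a single time step. -/
def NonlinearLayer.eval {ny nu : ℕ} : NonlinearLayer ny nu → (Fin ny → ℝ) → Fin nu → ℝ
  | .mlp ρ _ w, v => w.eval ρ v
  | .glu h σ W, v => fun j =>
      gelu (v (Fin.cast h.symm j)) * σ (W.mulVec (fun l => gelu (v l)) j)

/-! ### Deep SSM models -/

/-- An SSM block `u ↦ g ∘ S_Σ (u) + α u`. -/
structure SSMBlock (nu ny : ℕ) where
  ssm : SSM nu ny
  layer : NonlinearLayer ny nu
  res : ℝ

/-- The map of an SSM block on sequences of length `T`. -/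
def SSMBlock.eval {nu ny T : ℕ} (b : SSMBlock nu ny) (u : TSeq T nu) : TSeq T nu :=
  fun k => b.layer.eval (b.ssm.ioMap u k) + b.res • u k

/-- A deep SSM model of depth `L`: linear encoder, `L` SSM blocks, time pooling, linear decoder. -/
structure DeepSSM (L nin nu ny nout : ℕ) where
  enc : Matrix (Fin nu) (Fin nin) ℝ
  block : Fin L → SSMBlock nu ny
  dec : Matrix (Fin nout) (Fin nu) ℝ

/-- The pooling layer: the average over time. -/
def pool {T n : ℕ} (u : TSeq T n) : Fin n → ℝ := (T : ℝ)⁻¹ • ∑ k, u k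

namespace DeepSSM

variable {L nin nu ny nout : ℕ}

/-- The sequence obtained after the encoder and the first `i` blocks. -/
def hidden (f : DeepSSM L nin nu ny nout) {T : ℕ} (u : TSeq T nin) : ℕ → TSeq T nu
  | 0 => fun k => f.enc.mulVec (u k)
  | i + 1 => if h : i < L then (f.block ⟨i, h⟩).eval (f.hidden u i) else f.hidden u i

/-- The input-output map of the model. -/
def eval (f : DeepSSM L nin nu ny nout) {T : ℕ} (u : TSeq T nin) : Fin nout → ℝ :=
  f.dec.mulVec (pool (f.hidden u L))

end DeepSSM

/-! ### The constants of the bound -/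

/-- The possible types of a family of nonlinear layers, with the data common to its members:
ReLU MLPs with `M` hidden layers, MLPs with `M` hidden layers and sigmoid `ρ`, and GLU layers with
sigmoid `σ`; together with the bounds on their weights. -/
inductive LayerClass : Type
  | reluMLP (M : ℕ) (KW Kb : ℝ) : LayerClass
  | sigmoidMLP (ρ : ℝ → ℝ) (M : ℕ) (KW Kb : ℝ) : LayerClass
  | glu (σ : ℝ → ℝ) (K : ℝ) : LayerClass

namespace LayerClass

/-- MLPs have at least one hidden layer, and the sigmoids are admissible. -/
def Valid : LayerClass → Prop
  | reluMLP M _ _ => 1 ≤ M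
  | sigmoidMLP ρ M _ _ => IsSigmoid ρ ∧ 1 ≤ M
  | glu σ _ => IsSigmoid σ

/-- The layer `g` is of the given type and obeys its weight bounds. -/
def Admits {ny nu : ℕ} : LayerClass → NonlinearLayer ny nu → Prop
  | reluMLP M KW Kb, g => ∃ w : MLPWeights M ny nu, g = .mlp relu M w ∧ w.Bounded KW Kb
  | sigmoidMLP ρ M KW Kb, g => ∃ w : MLPWeights M ny nu, g = .mlp ρ M w ∧ w.Bounded KW Kb
  | glu σ K, g => ∃ (h : ny = nu) (W : Matrix (Fin nu) (Fin ny) ℝ),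
      g = .glu h σ W ∧ opNormInf W < K

/-- The constant `μ(r)`. -/
def mu : LayerClass → ℝ → ℝ
  | reluMLP M KW _, _ => (4 * KW) ^ (M + 1)
  | sigmoidMLP _ M KW _, _ => KW ^ (M + 1)
  | glu _ K, r => 16 * (r * (K + 1) ^ 2 + (K + 1))

/-- The constant `c(r)` (which does not depend on `r`). -/
def c : LayerClass → ℝ → ℝ
  | reluMLP M KW Kb, _ => 4 * Kb * ∑ q ∈ Finset.range (M + 1), (4 * KW) ^ q
  | sigmoidMLP _ M KW Kb, _ => (Kb + 1 / 2) * ∑ q ∈ Finset.range (M + 1), KW ^ q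
  | glu _ _, _ => 0

/-- The radius `r̂(r)` of a ball that contains the image of the ball of radius `r`. -/
def rhat : LayerClass → ℝ → ℝ
  | reluMLP M KW Kb, r => KW ^ (M + 1) * r + Kb * ∑ q ∈ Finset.range (M + 1), KW ^ q
  | sigmoidMLP _ _ KW Kb, _ => KW + Kb
  | glu _ _, r => r

end LayerClass

/-- The numerical data of a family of deep SSM models and of the learning problem. The block
`i ∈ {1, …, L}` has index `i - 1` here; values of `cls` and `res` at indices `≥ L` are irrelevant. -/
structure BoundData where
  L : ℕ
  cls : ℕ → LayerClass
  res : ℕ → ℝ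
  KEnc : ℝ
  KDec : ℝ
  K1 : ℝ
  K2 : ℝ
  Ku : ℝ
  Ky : ℝ
  Lip : ℝ

namespace BoundData

variable (P : BoundData)

/-- The bound on the operator norm of the SSM in block `i`: `K₂` for the first block
(as a map `ℓ² → ℓ^∞`), `K₁` for the others (as maps `ℓ^∞ → ℓ^∞`). -/
def gain : ℕ → ℝ
  | 0 => P.K2
  | _ + 1 => P.K1

/-- The radii: `radius i` bounds the input of the block with index `i`, and `radius L` bounds the
output of the last block. -/
def radius : ℕ → ℝ
  | 0 => P.KEnc * P.Ku
  | i + 1 => (P.cls i).rhat (P.gain i * radius i) + |P.res i| * radius i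

/-- The factor by which the block with index `i` can increase the Rademacher complexity. -/
def factor (i : ℕ) : ℝ :=
  (P.cls i).mu (P.gain i * P.radius i) * P.gain i + |P.res i|

/-- The constant `μ`. -/
def mu : ℝ := P.KEnc * P.KDec * ∏ i ∈ Finset.range P.L, P.factor i

/-- The constant `c`. -/
def c : ℝ :=
  P.KDec * ∑ j ∈ Finset.range P.L,
    (∏ i ∈ Finset.Ico (j + 1) P.L, P.factor i) * (P.cls j).c (P.gain j * P.radius j)

/-- The constant `K_l`. -/
def Kl : ℝ := 2 * P.Lip * max (P.KDec * P.radius P.L) P.Ky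

end BoundData

/-! ### The learning problem -/

/-- An elementwise loss `ℓ ≥ 0` with `ℓ(y, y') = 0` iff `y = y'`, which is Lipschitz with
constant `Lip`. -/
structure IsLipschitzLoss (loss : ℝ → ℝ → ℝ) (Lip : ℝ) : Prop where
  nonneg : ∀ y y', 0 ≤ loss y y'
  eq_zero_iff : ∀ y y', loss y y' = 0 ↔ y = y'
  lipschitz : ∀ y₁ y₁' y₂ y₂', loss y₁ y₁' - loss y₂ y₂' ≤ Lip * (|y₁ - y₂| + |y₁' - y₂'|)

/-- The true loss of a model with scalar output. -/
def trueLoss {L nin nu ny T : ℕ} (loss : ℝ → ℝ → ℝ) (𝒟 : Measure (TSeq T nin × ℝ))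
    (f : DeepSSM L nin nu ny 1) : ℝ :=
  ∫ z, loss (f.eval z.1 0) z.2 ∂𝒟

/-- The empirical loss of a model with scalar output on the sample `S`. -/
def empLoss {L nin nu ny T N : ℕ} (loss : ℝ → ℝ → ℝ) (S : Fin N → TSeq T nin × ℝ)
    (f : DeepSSM L nin nu ny 1) : ℝ :=
  (N : ℝ)⁻¹ * ∑ i, loss (f.eval (S i).1 0) (S i).2

/-- The assumptions on the family `F` of deep SSM models, the loss and the data distribution,
with the constants collected in `P`. -/
structure ModelAssumptions {nin nu ny T : ℕ} (P : BoundData)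
    (F : Set (DeepSSM P.L nin nu ny 1))
    (FEnc : Set (Matrix (Fin nu) (Fin nin) ℝ)) (FDec : Set (Matrix (Fin 1) (Fin nu) ℝ))
    (E : Set (SSM nu ny)) (Fnl : Fin P.L → Set (NonlinearLayer ny nu))
    (loss : ℝ → ℝ → ℝ) (𝒟 : Measure (TSeq T nin × ℝ)) : Prop where
  /-- All models have the same depth and residual weights and are built from the families. -/
  arch : ∀ f ∈ F, f.enc ∈ FEnc ∧ f.dec ∈ FDec ∧
    ∀ i, (f.block i).ssm ∈ E ∧ (f.block i).layer ∈ Fnl i ∧ (f.block i).res = P.res i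
  depth_pos : 1 ≤ P.L
  loss_lipschitz : IsLipschitzLoss loss P.Lip
  Ku_pos : 0 < P.Ku
  Ky_pos : 0 < P.Ky
  bounded_data : ∀ᵐ z ∂𝒟, TSeq.l2Norm z.1 ≤ P.Ku ∧ |z.2| ≤ P.Ky
  stable : ∀ s ∈ E, s.IsStable
  K1_nonneg : 0 ≤ P.K1
  K2_nonneg : 0 ≤ P.K2
  l1Norm_le : ∀ s ∈ E, s.l1Norm ≤ ENNReal.ofReal P.K1
  h2Norm_le : ∀ s ∈ E, s.h2Norm ≤ ENNReal.ofReal P.K2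
  enc_lt : ∀ W ∈ FEnc, opNormTwo W < P.KEnc
  dec_lt : ∀ W ∈ FDec, opNormInf W < P.KDec
  cls_valid : ∀ i : Fin P.L, (P.cls i).Valid
  layers : ∀ i, ∀ g ∈ Fnl i, (P.cls i).Admits g

end

/-!
The bound is a Rademacher complexity argument in which the length `T` of the sequences never enters.

For a finite class of functions with values in `[0, K]`, McDiarmid's inequality
(`measureReal_ge_le_of_bounded_differences`) and symmetrization (`integral_iSup_deviation_le`)
bound the uniform deviation by twice the Rademacher average plus a fluctuation of order `K / √N`
(`measureReal_exists_deviation_le`). The constants of the theorem leave room for the simple form of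
McDiarmid's inequality that is proved here.

The Rademacher average `rad v = 𝔼 sup_i ‖∑ₖ sₖ vᵢ(k)‖` of the model outputs is propagated through
the network layer by layer, with sequences measured in the supremum norm over time and
coordinates:
* the encoder and the first state-space model are controlled by a second moment in `ℓ²`, and
  `‖Σ‖₂` is a gain from `ℓ²` to `ℓ^∞`; for all later blocks `‖Σ‖₁` is a gain from `ℓ^∞` to `ℓ^∞`;
* an affine map costs the norm of its matrix and adds the norm of its bias times `√N`;
* an activation is handled by the contraction principle of Ledoux and Talagrand
  (`signAvg_iSup_le`). With absolute values inside the supremum it costs a factor `2`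
  (`rad_le_two_mul_rad`), but nothing if the activation is odd (`rad_le_rad_of_odd`), as a sigmoid
  is after subtraction of `1/2`;
* in a gated linear unit the gate is `1/2` plus an odd part, and the product of `GELU` with the odd
  part is turned into squares by polarisation (`rad_mul_le`); this needs the radius of the input,
  which is tracked by `DeepSSM.Conforms.norm_hidden_le`.

Decoder and pooling are bounded linear maps, and the loss is removed by the one-sided contraction
principle. The family of models may be uncountable, but the models are continuous functions of the
input. So the exceptional set is a union of open sets, hence a countable one, and its probability is
the supremum of those of the exceptional sets of finite subfamilies.
-/

open MeasureTheory ProbabilityTheory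

noncomputable section

/-! ### Averages over signs -/

/-- The vector of `±1` encoded by Booleans. -/
def signVec {n : ℕ} (σ : Fin n → Bool) : Fin n → ℝ := fun k => if σ k then 1 else -1

/-- The expectation of `Φ` at a vector of `n` independent uniform random signs. -/
def signAvg (n : ℕ) (Φ : (Fin n → ℝ) → ℝ) : ℝ := (2 ^ n : ℝ)⁻¹ * ∑ σ : Fin n → Bool, Φ (signVec σ)

/-- The entries of `s` are signs. -/
def IsSignVec {n : ℕ} (s : Fin n → ℝ) : Prop := ∀ k, s k = 1 ∨ s k = -1

lemma isSignVec_signVec {n : ℕ} (σ : Fin n → Bool) : IsSignVec (signVec σ) := by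
  intro k
  unfold signVec
  split_ifs <;> simp

lemma signAvg_mono {n : ℕ} {Φ Ψ : (Fin n → ℝ) → ℝ} (h : ∀ s, IsSignVec s → Φ s ≤ Ψ s) :
    signAvg n Φ ≤ signAvg n Ψ := by
  unfold signAvg
  gcongr with σ
  exact h _ (isSignVec_signVec σ)

lemma signAvg_add {n : ℕ} (Φ Ψ : (Fin n → ℝ) → ℝ) :
    signAvg n (fun s => Φ s + Ψ s) = signAvg n Φ + signAvg n Ψ := by
  simp [signAvg, Finset.sum_add_distrib, mul_add]

lemma signAvg_const_mul {n : ℕ} (c : ℝ) (Φ : (Fin n → ℝ) → ℝ) :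
    signAvg n (fun s => c * Φ s) = c * signAvg n Φ := by
  simp only [signAvg, ← Finset.mul_sum]
  ring

lemma signAvg_const (n : ℕ) (c : ℝ) : signAvg n (fun _ => c) = c := by
  simp [signAvg]

lemma signAvg_neg {n : ℕ} (Φ : (Fin n → ℝ) → ℝ) : signAvg n (fun s => Φ (-s)) = signAvg n Φ := by
  unfold signAvg
  congr 1
  refine Fintype.sum_equiv (Equiv.arrowCongr (Equiv.refl _) Equiv.boolNot) _ _ fun σ => ?_
  refine congrArg Φ (funext fun k => ?_)
  simp only [signVec, Pi.neg_apply, Equiv.arrowCongr_apply, Function.comp, Equiv.refl_symm,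
    Equiv.refl_apply, Equiv.boolNot_apply]
  cases σ k <;> simp

lemma signAvg_succ {n : ℕ} (Φ : (Fin (n + 1) → ℝ) → ℝ) :
    signAvg (n + 1) Φ = 2⁻¹ * (signAvg n (fun s => Φ (Fin.cons 1 s))
      + signAvg n (fun s => Φ (Fin.cons (-1) s))) := by
  have h : ∑ σ : Fin (n + 1) → Bool, Φ (signVec σ)
      = ∑ p : Bool × (Fin n → Bool), Φ (signVec (Fin.cons p.1 p.2 : Fin (n + 1) → Bool)) :=
    (Fintype.sum_equiv (Fin.consEquiv fun _ => Bool) _ _ fun p => rfl).symm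
  have h' : ∀ (b : Bool) (σ : Fin n → Bool), signVec (Fin.cons b σ : Fin (n + 1) → Bool)
      = Fin.cons (if b then 1 else -1) (signVec σ) := by
    intro b σ
    funext k
    refine Fin.cases ?_ (fun k => ?_) k <;> simp [signVec]
  simp only [signAvg, h, Fintype.sum_prod_type, Fintype.sum_bool, h', pow_succ]
  simp only [if_true, Bool.false_eq_true, if_false]
  rw [mul_inv]
  ring

lemma signAvg_sq_le {n : ℕ} (Φ : (Fin n → ℝ) → ℝ) :
    signAvg n Φ ^ 2 ≤ signAvg n (fun s => Φ s ^ 2) := by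
  have h := sq_sum_le_card_mul_sum_sq (s := (Finset.univ : Finset (Fin n → Bool)))
    (f := fun σ => Φ (signVec σ))
  have hc : ((Finset.univ : Finset (Fin n → Bool)).card : ℝ) = 2 ^ n := by simp
  rw [hc] at h
  unfold signAvg
  rw [mul_pow]
  calc ((2 ^ n : ℝ)⁻¹) ^ 2 * (∑ σ, Φ (signVec σ)) ^ 2
      ≤ ((2 ^ n : ℝ)⁻¹) ^ 2 * (2 ^ n * ∑ σ, Φ (signVec σ) ^ 2) := by gcongr
    _ = (2 ^ n : ℝ)⁻¹ * ∑ σ, Φ (signVec σ) ^ 2 := by field_simp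

/-- Independent signs are orthonormal. -/
lemma signAvg_sum_sq {n : ℕ} (a : ℝ) (x : Fin n → ℝ) :
    signAvg n (fun s => (a + ∑ k, s k * x k) ^ 2) = a ^ 2 + ∑ k, x k ^ 2 := by
  induction n generalizing a with
  | zero => simp [signAvg]
  | succ n ih =>
    rw [signAvg_succ]
    simp only [Fin.sum_univ_succ, Fin.cons_zero, Fin.cons_succ, ← add_assoc]
    rw [ih (a + 1 * x 0) fun k => x k.succ, ih (a + -1 * x 0) fun k => x k.succ]
    ring

lemma signAvg_sum {n : ℕ} {J : Type*} [Fintype J] (Φ : J → (Fin n → ℝ) → ℝ) :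
    signAvg n (fun s => ∑ j, Φ j s) = ∑ j, signAvg n (Φ j) := by
  simp only [signAvg, ← Finset.mul_sum]
  rw [Finset.sum_comm]

/-! ### Contraction -/

section Contraction

variable {ι : Type*} [Finite ι]

lemma le_iSup_finite (f : ι → ℝ) (i : ι) : f i ≤ ⨆ i, f i :=
  le_ciSup (Set.finite_range f).bddAbove i

/-- The two-point case of the contraction principle. -/
lemma iSup_add_iSup_sub_le [Nonempty ι] (b x y : ι → ℝ)
    (h : ∀ i j, |y i - y j| ≤ |x i - x j|) :
    (⨆ i, (b i + y i)) + ⨆ i, (b i - y i) ≤ (⨆ i, (b i + x i)) + ⨆ i, (b i - x i) := by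
  obtain ⟨i, hi⟩ := exists_eq_ciSup_of_finite (f := fun i => b i + y i)
  obtain ⟨j, hj⟩ := exists_eq_ciSup_of_finite (f := fun i => b i - y i)
  rw [← hi, ← hj]
  have h1 := le_iSup_finite (fun i => b i + x i) i
  have h2 := le_iSup_finite (fun i => b i + x i) j
  have h3 := le_iSup_finite (fun i => b i - x i) i
  have h4 := le_iSup_finite (fun i => b i - x i) j
  have h5 := (le_abs_self _).trans (h i j)
  rcases abs_cases (x i - x j) with ⟨e, _⟩ | ⟨e, _⟩ <;> linarith

/-- The **contraction principle** of Ledoux and Talagrand, one-sided form: coordinatewise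
non-expansive images have a smaller Rademacher average. -/
theorem signAvg_iSup_le [Nonempty ι] {n : ℕ} (a : ι → ℝ) (x y : ι → Fin n → ℝ)
    (h : ∀ k i j, |y i k - y j k| ≤ |x i k - x j k|) :
    signAvg n (fun s => ⨆ i, (a i + ∑ k, s k * y i k))
      ≤ signAvg n (fun s => ⨆ i, (a i + ∑ k, s k * x i k)) := by
  induction n generalizing a with
  | zero => simp
  | succ n ih =>
    rw [signAvg_succ, signAvg_succ]
    simp only [Fin.sum_univ_succ, Fin.cons_zero, Fin.cons_succ, ← add_assoc]
    have h1 := ih (fun i => a i + 1 * y i 0) (fun i k => x i k.succ) (fun i k => y i k.succ)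
      fun k => h k.succ
    have h2 := ih (fun i => a i + -1 * y i 0) (fun i k => x i k.succ) (fun i k => y i k.succ)
      fun k => h k.succ
    refine mul_le_mul_of_nonneg_left ((add_le_add h1 h2).trans ?_) (by norm_num)
    rw [← signAvg_add, ← signAvg_add]
    refine signAvg_mono fun s _ => ?_
    convert iSup_add_iSup_sub_le (fun i => a i + ∑ k : Fin n, s k * x i k.succ)
      (fun i => x i 0) (fun i => y i 0) (h 0) using 3 <;> (funext i; ring)

end Contraction

/-! ### Rademacher averages of families of vectors -/

/-- The (unnormalised) Rademacher average `𝔼 sup_i ‖∑ₖ sₖ vᵢ(k)‖` of a family of `n`-tuples of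
vectors. The spaces may vary with the member of the family, since networks of one family
may have different hidden widths. -/
def rad {I : Type*} {n : ℕ} {E : I → Type*} [∀ i, SeminormedAddCommGroup (E i)]
    [∀ i, NormedSpace ℝ (E i)] (v : (i : I) → Fin n → E i) : ℝ :=
  signAvg n fun s => ⨆ i, ‖∑ k, s k • v i k‖

lemma rad_nonneg {I : Type*} {n : ℕ} {E : I → Type*} [∀ i, SeminormedAddCommGroup (E i)]
    [∀ i, NormedSpace ℝ (E i)] (v : (i : I) → Fin n → E i) : 0 ≤ rad v := by
  rw [← signAvg_const n 0]
  exact signAvg_mono fun s _ => Real.iSup_nonneg fun i => norm_nonneg _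

lemma rad_le_signAvg {I : Type*} {n : ℕ} {E : I → Type*} [∀ i, SeminormedAddCommGroup (E i)]
    [∀ i, NormedSpace ℝ (E i)] {v : (i : I) → Fin n → E i} {B : (Fin n → ℝ) → ℝ}
    (hB : ∀ s, 0 ≤ B s) (h : ∀ s, IsSignVec s → ∀ i, ‖∑ k, s k • v i k‖ ≤ B s) :
    rad v ≤ signAvg n B :=
  signAvg_mono fun s hs => Real.iSup_le (h s hs) (hB s)

section Rad

variable {I J : Type*} {n : ℕ} {E : I → Type*} {G : J → Type*}
  [∀ i, SeminormedAddCommGroup (E i)] [∀ i, NormedSpace ℝ (E i)]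
  [∀ i, SeminormedAddCommGroup (G i)] [∀ i, NormedSpace ℝ (G i)]

lemma rad_le_mul_rad [Finite J] (v : (i : I) → Fin n → E i) (w : (j : J) → Fin n → G j) {C : ℝ}
    (hC : 0 ≤ C)
    (h : ∀ s : Fin n → ℝ, ∀ i, ∃ j, ‖∑ k, s k • v i k‖ ≤ C * ‖∑ k, s k • w j k‖) :
    rad v ≤ C * rad w := by
  unfold rad
  rw [← signAvg_const_mul]
  refine signAvg_mono fun s _ => Real.iSup_le (fun i => ?_)
    (mul_nonneg hC (Real.iSup_nonneg fun i => norm_nonneg _))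
  obtain ⟨j, hj⟩ := h s i
  exact hj.trans (mul_le_mul_of_nonneg_left
    (le_iSup_finite (fun j => ‖∑ k, s k • w j k‖) j) hC)

lemma rad_add_le [Finite I] (v w : (i : I) → Fin n → E i) :
    rad (fun i k => v i k + w i k) ≤ rad v + rad w := by
  unfold rad
  rw [← signAvg_add]
  refine signAvg_mono fun s _ => Real.iSup_le (fun i => ?_)
    (add_nonneg (Real.iSup_nonneg fun i => norm_nonneg _)
      (Real.iSup_nonneg fun i => norm_nonneg _))
  simp only [smul_add, Finset.sum_add_distrib]
  exact (norm_add_le _ _).trans (add_le_add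
    (le_iSup_finite (fun j => ‖∑ k, s k • v j k‖) i)
    (le_iSup_finite (fun j => ‖∑ k, s k • w j k‖) i))

lemma rad_smul_le [Finite I] (v : (i : I) → Fin n → E i) (c : ℝ) :
    rad (fun i k => c • v i k) ≤ |c| * rad v := by
  refine rad_le_mul_rad _ _ (abs_nonneg c) fun s i => ⟨i, ?_⟩
  simp only [smul_comm _ c, ← Finset.smul_sum, norm_smul, Real.norm_eq_abs, le_refl]

lemma signAvg_sqrt_sum_sq_le {n : ℕ} {J : Type*} [Fintype J] (u : Fin n → J → ℝ) :
    signAvg n (fun s => √(∑ j, (∑ k, s k * u k j) ^ 2)) ≤ √(∑ k, ∑ j, u k j ^ 2) := by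
  refine Real.le_sqrt_of_sq_le ((signAvg_sq_le _).trans ?_)
  have h : ∀ s : Fin n → ℝ, √(∑ j, (∑ k, s k * u k j) ^ 2) ^ 2 = ∑ j, (∑ k, s k * u k j) ^ 2 :=
    fun s => Real.sq_sqrt (Finset.sum_nonneg fun j _ => sq_nonneg _)
  simp only [h]
  rw [signAvg_sum, Finset.sum_comm]
  refine Finset.sum_le_sum fun j _ => ?_
  simpa using (signAvg_sum_sq 0 fun k => u k j).le

/-- A bias shared by all samples contributes the mean length of a random walk. -/
lemma rad_const_le (b : (i : I) → E i) {K : ℝ} (hK : 0 ≤ K) (hb : ∀ i, ‖b i‖ ≤ K) :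
    rad (fun i (_ : Fin n) => b i) ≤ K * √n := by
  have h : rad (fun i (_ : Fin n) => b i)
      ≤ signAvg n (fun s => K * √(∑ _j : Fin 1, (∑ k, s k * 1) ^ 2)) := by
    refine rad_le_signAvg (fun s => by positivity) fun s _ i => ?_
    rw [← Finset.sum_smul, norm_smul, mul_comm]
    simp only [Finset.univ_unique, Finset.sum_const, Finset.card_singleton, one_smul, mul_one]
    rw [Real.sqrt_sq_eq_abs, Real.norm_eq_abs]
    exact mul_le_mul_of_nonneg_right (hb i) (abs_nonneg _)
  rw [signAvg_const_mul] at h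
  refine h.trans (mul_le_mul_of_nonneg_left ?_ hK)
  refine (signAvg_sqrt_sum_sq_le (fun _ _ => 1)).trans (le_of_eq ?_)
  simp

/-- For the supremum norm, the coordinates of the vectors can be treated as separate members. -/
lemma rad_pi [Finite I] {K : I → Type*} [∀ i, Fintype (K i)] {H : (i : I) → K i → Type*}
    [∀ i l, SeminormedAddCommGroup (H i l)] [∀ i l, NormedSpace ℝ (H i l)]
    (v : (i : I) → Fin n → (l : K i) → H i l) :
    rad v = rad (E := fun p : (Σ i, K i) => H p.1 p.2) (fun p k => v p.1 k p.2) := by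
  unfold rad
  congr 1
  funext s
  have hn : ∀ i l, (∑ k, s k • v i k) l = ∑ k, s k • v i k l := fun i l => by
    simp [Finset.sum_apply]
  apply le_antisymm
  · refine Real.iSup_le (fun i => ?_) (Real.iSup_nonneg fun i => norm_nonneg _)
    refine (pi_norm_le_iff_of_nonneg (Real.iSup_nonneg fun i => norm_nonneg _)).2 fun l => ?_
    rw [hn]
    exact le_iSup_finite (fun p : (Σ i, K i) => ‖∑ k, s k • v p.1 k p.2‖) ⟨i, l⟩
  · refine Real.iSup_le (fun p => ?_) (Real.iSup_nonneg fun i => norm_nonneg _)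
    rw [← hn]
    exact (norm_le_pi_norm _ p.2).trans (le_iSup_finite (fun i => ‖∑ k, s k • v i k‖) p.1)

end Rad

section AbsContraction

variable {ι : Type*} [Finite ι] {n : ℕ}

/-- For odd non-expansive maps the contraction principle holds with absolute values and without
loss: the index set is made symmetric. -/
theorem rad_le_rad_of_odd (x y : ι → Fin n → ℝ)
    (h : ∀ k i j, |y i k - y j k| ≤ |x i k - x j k|)
    (h' : ∀ k i j, |y i k + y j k| ≤ |x i k + x j k|) :
    rad y ≤ rad x := by
  cases isEmpty_or_nonempty ι
  · simp [rad]
  have key : ∀ z : ι → Fin n → ℝ, rad z = signAvg n fun s =>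
      ⨆ p : ι × Bool, ((0 : ℝ) + ∑ k, s k * (if p.2 then z p.1 k else -z p.1 k)) := by
    intro z
    unfold rad
    congr 1
    funext s
    simp only [smul_eq_mul, Real.norm_eq_abs, zero_add]
    apply le_antisymm
    · refine ciSup_le fun i => abs_le'.2 ⟨?_, ?_⟩
      · simpa using le_iSup_finite
          (fun p : ι × Bool => ∑ k, s k * (if p.2 then z p.1 k else -z p.1 k)) (i, true)
      · simpa using le_iSup_finite
          (fun p : ι × Bool => ∑ k, s k * (if p.2 then z p.1 k else -z p.1 k)) (i, false)
    · refine ciSup_le fun p => le_trans ?_ (le_iSup_finite (fun i => |∑ k, s k * z i k|) p.1)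
      rcases p with ⟨i, _ | _⟩
      · simpa using neg_le_abs _
      · simpa using le_abs_self _
  rw [key, key]
  refine signAvg_iSup_le _ _ _ fun k p q => ?_
  have e1 : ∀ a b : ℝ, |a - -b| = |a + b| := fun a b => by rw [sub_neg_eq_add]
  have e2 : ∀ a b : ℝ, |-a - b| = |a + b| := fun a b => by
    rw [← abs_neg]; congr 1; ring
  have e4 : ∀ a b : ℝ, |-a + b| = |a - b| := fun a b => by
    rw [← abs_neg]; congr 1; ring
  rcases p with ⟨i, _ | _⟩ <;> rcases q with ⟨j, _ | _⟩ <;>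
    simp only [Bool.false_eq_true, if_false, if_true, e1, e2, e4, h, h']

/-- For non-expansive maps that fix `0` the contraction principle with absolute values costs a
factor `2`: the positive and the negative part are contracted separately. -/
theorem rad_le_two_mul_rad (x y : ι → Fin n → ℝ)
    (h : ∀ k i j, |y i k - y j k| ≤ |x i k - x j k|) (h' : ∀ k i, |y i k| ≤ |x i k|) :
    rad y ≤ 2 * rad x := by
  -- the member `none`, which vanishes, turns the supremum into that of the positive parts
  let ext : (ι → Fin n → ℝ) → Option ι → Fin n → ℝ := fun z o k => o.elim 0 fun i => z i k
  let Q : (ι → Fin n → ℝ) → (Fin n → ℝ) → ℝ := fun z s => ⨆ o, ((0 : ℝ) + ∑ k, s k * ext z o k)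
  have hQ : ∀ z s i, ∑ k, s k * z i k ≤ Q z s := fun z s i => by
    simpa [ext, Q] using le_iSup_finite (fun o => (0 : ℝ) + ∑ k, s k * ext z o k) (some i)
  have hQ0 : ∀ z s, 0 ≤ Q z s := fun z s => by
    simpa [ext, Q] using le_iSup_finite (fun o => (0 : ℝ) + ∑ k, s k * ext z o k) none
  have hy : rad y ≤ signAvg n (Q y) + signAvg n (Q y) := by
    nth_rewrite 2 [← signAvg_neg (Q y)]
    rw [← signAvg_add]
    refine rad_le_signAvg (fun s => add_nonneg (hQ0 _ _) (hQ0 _ _)) fun s _ i => ?_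
    simp only [smul_eq_mul, Real.norm_eq_abs]
    refine abs_le'.2 ⟨(hQ y s i).trans (le_add_of_nonneg_right (hQ0 _ _)),
      le_trans ?_ (le_add_of_nonneg_left (hQ0 _ _))⟩
    simpa using hQ y (-s) i
  have hx : signAvg n (Q x) ≤ rad x := by
    refine signAvg_mono fun s _ => ciSup_le fun o => ?_
    rcases o with _ | i
    · simpa [ext] using Real.iSup_nonneg fun i => abs_nonneg _
    · simp only [ext, Option.elim_some, zero_add]
      exact (le_abs_self _).trans (le_iSup_finite (fun i => ‖∑ k, s k • x i k‖) i)
  have hxy : signAvg n (Q y) ≤ signAvg n (Q x) := by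
    refine signAvg_iSup_le _ _ _ fun k p q => ?_
    rcases p with _ | i <;> rcases q with _ | j <;> simp [ext, h, h']
  linarith

variable {I : Type*} [Finite I] {m : I → ℕ}

lemma rad_map_le_rad_of_odd (φ : ℝ → ℝ) (hφ : LipschitzWith 1 φ) (hodd : ∀ t, φ (-t) = -φ t)
    (v : (i : I) → Fin n → Fin (m i) → ℝ) :
    rad (fun i k j => φ (v i k j)) ≤ rad v := by
  have hl : ∀ s t, |φ s - φ t| ≤ |s - t| := fun s t => by
    simpa [Real.dist_eq] using hφ.dist_le_mul s t
  rw [rad_pi, rad_pi v]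
  refine rad_le_rad_of_odd _ _ (fun k p q => hl _ _) fun k p q => ?_
  simpa [hodd] using hl (v p.1 k p.2) (-(v q.1 k q.2))

lemma rad_map_le_two_mul_rad (φ : ℝ → ℝ) (hφ : LipschitzWith 1 φ) (h0 : φ 0 = 0)
    (v : (i : I) → Fin n → Fin (m i) → ℝ) :
    rad (fun i k j => φ (v i k j)) ≤ 2 * rad v := by
  have hl : ∀ s t, |φ s - φ t| ≤ |s - t| := fun s t => by
    simpa [Real.dist_eq] using hφ.dist_le_mul s t
  rw [rad_pi, rad_pi v]
  refine rad_le_two_mul_rad _ _ (fun k p q => hl _ _) fun k p => ?_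
  simpa [h0] using hl (v p.1 k p.2) 0

end AbsContraction

/-! ### Nonlinear layers: size, continuity, Rademacher averages -/

lemma norm_mulVec_le {m n : ℕ} (W : Matrix (Fin m) (Fin n) ℝ) (x : Fin n → ℝ) :
    ‖W.mulVec x‖ ≤ opNormInf W * ‖x‖ := by
  simpa [opNormInf] using (LinearMap.toContinuousLinearMap (Matrix.toLin' W)).le_opNorm x

lemma opNormInf_nonneg {m n : ℕ} (W : Matrix (Fin m) (Fin n) ℝ) : 0 ≤ opNormInf W := norm_nonneg _

lemma mulVec_sum_smul {m n N : ℕ} (W : Matrix (Fin m) (Fin n) ℝ) (s : Fin N → ℝ)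
    (x : Fin N → Fin n → ℝ) : ∑ k, s k • W.mulVec (x k) = W.mulVec (∑ k, s k • x k) := by
  rw [Matrix.mulVec_sum]
  simp only [Matrix.mulVec_smul]

lemma norm_comp_le {n : ℕ} {φ : ℝ → ℝ} (hφ : ∀ t, |φ t| ≤ |t|) (v : Fin n → ℝ) :
    ‖fun j => φ (v j)‖ ≤ ‖v‖ :=
  (pi_norm_le_iff_of_nonneg (norm_nonneg _)).2 fun j => (hφ _).trans (norm_le_pi_norm v j)

lemma rad_mulVec_le {I : Type*} [Finite I] {n : ℕ} {m o : I → ℕ}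
    (W : (i : I) → Matrix (Fin (o i)) (Fin (m i)) ℝ) (v : (i : I) → Fin n → Fin (m i) → ℝ)
    {K : ℝ} (hK : 0 ≤ K) (hW : ∀ i, opNormInf (W i) ≤ K) :
    rad (fun i k => (W i).mulVec (v i k)) ≤ K * rad v := by
  refine rad_le_mul_rad _ _ hK fun s i => ⟨i, ?_⟩
  rw [mulVec_sum_smul]
  exact (norm_mulVec_le _ _).trans (mul_le_mul_of_nonneg_right (hW i) (norm_nonneg _))

lemma rad_affine_le {I : Type*} [Finite I] {n : ℕ} {m o : I → ℕ}
    (W : (i : I) → Matrix (Fin (o i)) (Fin (m i)) ℝ) (b : (i : I) → Fin (o i) → ℝ)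
    (v : (i : I) → Fin n → Fin (m i) → ℝ) {K Kb : ℝ} (hK : 0 ≤ K) (hKb : 0 ≤ Kb)
    (hW : ∀ i, opNormInf (W i) ≤ K) (hb : ∀ i, ‖b i‖ ≤ Kb) :
    rad (fun i k => (W i).mulVec (v i k) + b i) ≤ K * rad v + Kb * √n :=
  (rad_add_le _ _).trans (add_le_add (rad_mulVec_le W v hK hW) (rad_const_le b hKb hb))

/-! #### Activation functions -/

lemma lipschitzWith_relu : LipschitzWith 1 relu := by
  have := LipschitzWith.id.max_const (α := ℝ) 0
  exact this

lemma relu_zero : relu 0 = 0 := by simp [relu]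

lemma abs_relu_le (t : ℝ) : |relu t| ≤ |t| := by
  simpa [relu_zero, Real.dist_eq] using lipschitzWith_relu.dist_le_mul t 0

namespace IsSigmoid

variable {ρ : ℝ → ℝ}

lemma abs_le_one (h : IsSigmoid ρ) (t : ℝ) : |ρ t| ≤ 1 := abs_le.2 (h.mem_Icc t)

lemma lipschitz_sub (h : IsSigmoid ρ) : LipschitzWith 1 (fun t => ρ t - 1 / 2) := by
  refine LipschitzWith.of_dist_le_mul fun x y => ?_
  simpa [Real.dist_eq] using h.lipschitz.dist_le_mul x y

lemma odd_sub (h : IsSigmoid ρ) (t : ℝ) : ρ (-t) - 1 / 2 = -(ρ t - 1 / 2) := by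
  simpa [h.zero] using h.odd t

/-- Since `ρ - 1/2` is odd, the upper bound `ρ ≤ 1` bounds it from both sides. -/
lemma abs_sub_le (h : IsSigmoid ρ) (t : ℝ) : |ρ t - 1 / 2| ≤ 1 / 2 := by
  have h1 := (h.mem_Icc t).2
  have h2 := (h.mem_Icc (-t)).2
  have h3 := h.odd_sub t
  rw [abs_le]
  constructor <;> linarith

end IsSigmoid

lemma hasDerivAt_gaussian_cdf (x : ℝ) :
    HasDerivAt (fun x => (gaussianReal 0 1).real (Set.Iic x)) (gaussianPDFReal 0 1 x) x := by
  have hc : Continuous (gaussianPDFReal 0 1) := by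
    rw [gaussianPDFReal_def]
    fun_prop
  have hi := integrable_gaussianPDFReal 0 1
  have h : ∀ y, (gaussianReal 0 1).real (Set.Iic y)
      = (∫ t in Set.Iic 0, gaussianPDFReal 0 1 t) + ∫ t in (0 : ℝ)..y, gaussianPDFReal 0 1 t := by
    intro y
    rw [← intervalIntegral.integral_Iic_sub_Iic hi.integrableOn hi.integrableOn, measureReal_def,
      gaussianReal_apply_eq_integral 0 one_ne_zero, ENNReal.toReal_ofReal]
    · ring
    · exact integral_nonneg fun t => gaussianPDFReal_nonneg _ _ _
  rw [funext h]
  exact (intervalIntegral.integral_hasDerivAt_right (hc.intervalIntegrable _ _)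
    hc.stronglyMeasurable.stronglyMeasurableAtFilter hc.continuousAt).const_add _

lemma abs_mul_gaussianPDFReal_le (x : ℝ) : |x| * gaussianPDFReal 0 1 x ≤ 1 := by
  have h1 : (√(2 * Real.pi))⁻¹ ≤ 1 := by
    refine inv_le_one_of_one_le₀ (Real.one_le_sqrt.2 ?_)
    linarith [Real.pi_gt_three]
  have h2 : |x| ≤ Real.exp (x ^ 2 / 2) := by
    have := Real.add_one_le_exp (x ^ 2 / 2)
    nlinarith [sq_nonneg (|x| - 1), sq_abs x]
  have h3 : gaussianPDFReal 0 1 x = (√(2 * Real.pi))⁻¹ * (Real.exp (x ^ 2 / 2))⁻¹ := by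
    rw [gaussianPDFReal_def, ← Real.exp_neg]
    simp [neg_div]
  rw [h3]
  calc |x| * ((√(2 * Real.pi))⁻¹ * (Real.exp (x ^ 2 / 2))⁻¹)
      ≤ Real.exp (x ^ 2 / 2) * (1 * (Real.exp (x ^ 2 / 2))⁻¹) := by gcongr
    _ = 1 := by rw [one_mul, mul_inv_cancel₀ (Real.exp_pos _).ne']

lemma gelu_zero : gelu 0 = 0 := by simp [gelu]

lemma abs_gelu_le (t : ℝ) : |gelu t| ≤ |t| := by
  rw [gelu, abs_mul, abs_of_nonneg measureReal_nonneg]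
  exact mul_le_of_le_one_right (abs_nonneg _) measureReal_le_one

lemma lipschitzWith_gelu : LipschitzWith 2 gelu := by
  have hd : ∀ x, HasDerivAt gelu (1 * (gaussianReal 0 1).real (Set.Iic x)
      + x * gaussianPDFReal 0 1 x) x := fun x => (hasDerivAt_id x).mul (hasDerivAt_gaussian_cdf x)
  refine lipschitzWith_of_nnnorm_deriv_le (fun x => (hd x).differentiableAt) fun x => ?_
  rw [(hd x).deriv, ← NNReal.coe_le_coe, coe_nnnorm]
  refine (norm_add_le _ _).trans ?_
  have h1 : (gaussianReal 0 1).real (Set.Iic x) ≤ 1 := measureReal_le_one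
  have h2 := abs_mul_gaussianPDFReal_le x
  rw [one_mul, Real.norm_of_nonneg measureReal_nonneg, Real.norm_eq_abs, abs_mul,
    abs_of_nonneg (gaussianPDFReal_nonneg 0 1 x)]
  push_cast
  linarith

/-! #### Multilayer perceptrons -/

namespace MLPWeights

lemma exists_eq_output {i o : ℕ} (w : MLPWeights 0 i o) : ∃ W b, w = output W b := by
  cases w
  exact ⟨_, _, rfl⟩

lemma exists_eq_hidden {M i o : ℕ} (w : MLPWeights (M + 1) i o) :
    ∃ (h : ℕ) (W : Matrix (Fin h) (Fin i) ℝ) (b : Fin h → ℝ) (rest : MLPWeights M h o),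
      w = hidden W b rest := by
  cases w
  exact ⟨_, _, _, _, rfl⟩

lemma Bounded.pos {KW Kb : ℝ} {M i o : ℕ} {w : MLPWeights M i o} (h : w.Bounded KW Kb) :
    0 < KW ∧ 0 < Kb := by
  cases w with
  | output W b => exact ⟨(opNormInf_nonneg W).trans_lt h.1, (norm_nonneg b).trans_lt h.2⟩
  | hidden W b rest => exact ⟨(opNormInf_nonneg W).trans_lt h.1.1, (norm_nonneg b).trans_lt h.1.2⟩

lemma continuous_eval {ρ : ℝ → ℝ} (hρ : Continuous ρ) {M i o : ℕ} (w : MLPWeights M i o) :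
    Continuous (w.eval ρ) := by
  induction w with
  | output W b =>
    have : Continuous fun x => W.mulVec x + b := by fun_prop
    exact this
  | hidden W b rest ih =>
    have h : Continuous fun x => W.mulVec x + b := by fun_prop
    exact ih.comp (continuous_pi fun j => hρ.comp ((continuous_apply j).comp h))

lemma norm_affine_le {m n : ℕ} {W : Matrix (Fin m) (Fin n) ℝ} {b : Fin m → ℝ} {KW Kb r : ℝ}
    (hW : opNormInf W ≤ KW) (hb : ‖b‖ ≤ Kb) {x : Fin n → ℝ} (hx : ‖x‖ ≤ r) :
    ‖W.mulVec x + b‖ ≤ KW * r + Kb := by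
  have hK := (opNormInf_nonneg W).trans hW
  refine (norm_add_le _ _).trans (add_le_add ((norm_mulVec_le W x).trans ?_) hb)
  gcongr

lemma norm_eval_relu_le {KW Kb : ℝ} {M i o : ℕ} (w : MLPWeights M i o) (hw : w.Bounded KW Kb)
    {r : ℝ} {x : Fin i → ℝ} (hx : ‖x‖ ≤ r) :
    ‖w.eval relu x‖ ≤ KW ^ (M + 1) * r + Kb * ∑ q ∈ Finset.range (M + 1), KW ^ q := by
  induction w generalizing r with
  | output W b => simpa [eval] using norm_affine_le hw.1.le hw.2.le hx
  | @hidden M i h o W b rest ih =>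
    have := ih hw.2 ((norm_comp_le abs_relu_le _).trans (norm_affine_le hw.1.1.le hw.1.2.le hx))
    refine this.trans (le_of_eq ?_)
    rw [Finset.sum_range_succ _ (M + 1)]
    ring

lemma norm_eval_sigmoid_le {ρ : ℝ → ℝ} (hρ : IsSigmoid ρ) {KW Kb : ℝ} {M i o : ℕ}
    (w : MLPWeights M i o) (hw : w.Bounded KW Kb) {x : Fin i → ℝ} (hx : M = 0 → ‖x‖ ≤ 1) :
    ‖w.eval ρ x‖ ≤ KW + Kb := by
  induction w with
  | output W b => simpa [eval] using norm_affine_le hw.1.le hw.2.le (hx rfl)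
  | hidden W b rest ih =>
    exact ih hw.2 fun _ => (pi_norm_le_iff_of_nonneg zero_le_one).2 fun j => hρ.abs_le_one _

/-- Every hidden layer costs the factor `2 KW`: one `KW` for the affine map and the `2` of the
contraction principle for an activation that is not odd. -/
lemma rad_eval_relu_le {I : Type*} [Finite I] {n : ℕ} {KW Kb : ℝ} (hKW : 0 ≤ KW) (hKb : 0 ≤ Kb)
    {M : ℕ} {m o : I → ℕ} (w : (i : I) → MLPWeights M (m i) (o i))
    (hw : ∀ i, (w i).Bounded KW Kb) (v : (i : I) → Fin n → Fin (m i) → ℝ) :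
    rad (fun i k => (w i).eval relu (v i k)) ≤ (4 * KW) ^ (M + 1) * rad v
      + 4 * Kb * (∑ q ∈ Finset.range (M + 1), (4 * KW) ^ q) * √n := by
  have hn : 0 ≤ √(n : ℝ) := Real.sqrt_nonneg _
  induction M generalizing m with
  | zero =>
    choose W b hWb using fun i => exists_eq_output (w i)
    have hB : ∀ i, opNormInf (W i) < KW ∧ ‖b i‖ < Kb := fun i => by
      have := hw i
      rwa [hWb i] at this
    simp only [hWb, eval]
    refine (rad_affine_le W b v hKW hKb (fun i => (hB i).1.le) fun i => (hB i).2.le).trans ?_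
    have h1 := mul_nonneg hKW (rad_nonneg v)
    have h2 := mul_nonneg hKb hn
    simp
    linarith
  | succ M ih =>
    choose h W b w' hWb using fun i => exists_eq_hidden (w i)
    have hB : ∀ i, (opNormInf (W i) < KW ∧ ‖b i‖ < Kb) ∧ (w' i).Bounded KW Kb := fun i => by
      have := hw i
      rwa [hWb i] at this
    simp only [hWb, eval]
    refine (ih w' (fun i => (hB i).2) _).trans ?_
    have h1 := (rad_map_le_two_mul_rad relu lipschitzWith_relu relu_zero
      fun i k => (W i).mulVec (v i k) + b i).trans (mul_le_mul_of_nonneg_left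
        (rad_affine_le W b v hKW hKb (fun i => (hB i).1.1.le) fun i => (hB i).1.2.le)
        zero_le_two)
    have h2 : 2 * (KW * rad v + Kb * √n) ≤ 4 * KW * rad v + 4 * Kb * √n := by
      have h1 := mul_nonneg hKW (rad_nonneg v)
      have h2 := mul_nonneg hKb hn
      linarith
    calc _ ≤ (4 * KW) ^ (M + 1) * (4 * KW * rad v + 4 * Kb * √n)
          + 4 * Kb * (∑ q ∈ Finset.range (M + 1), (4 * KW) ^ q) * √n := by
          gcongr
          exact h1.trans h2
      _ = _ := by
          rw [Finset.sum_range_succ _ (M + 1)]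
          ring

/-- The odd part `ρ - 1/2` of the activation contracts without loss, and the constant `1/2`
acts as an additional bias. -/
lemma rad_eval_sigmoid_le {ρ : ℝ → ℝ} (hρ : IsSigmoid ρ) {I : Type*} [Finite I] {n : ℕ}
    {KW Kb : ℝ} (hKW : 0 ≤ KW) (hKb : 0 ≤ Kb)
    {M : ℕ} {m o : I → ℕ} (w : (i : I) → MLPWeights M (m i) (o i))
    (hw : ∀ i, (w i).Bounded KW Kb) (v : (i : I) → Fin n → Fin (m i) → ℝ) :
    rad (fun i k => (w i).eval ρ (v i k)) ≤ KW ^ (M + 1) * rad v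
      + (Kb + 1 / 2) * (∑ q ∈ Finset.range (M + 1), KW ^ q) * √n := by
  have hn : 0 ≤ √(n : ℝ) := Real.sqrt_nonneg _
  induction M generalizing m with
  | zero =>
    choose W b hWb using fun i => exists_eq_output (w i)
    have hB : ∀ i, opNormInf (W i) < KW ∧ ‖b i‖ < Kb := fun i => by
      have := hw i
      rwa [hWb i] at this
    simp only [hWb, eval]
    refine (rad_affine_le W b v hKW hKb (fun i => (hB i).1.le) fun i => (hB i).2.le).trans ?_
    simp
    linarith
  | succ M ih =>
    choose h W b w' hWb using fun i => exists_eq_hidden (w i)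
    have hB : ∀ i, (opNormInf (W i) < KW ∧ ‖b i‖ < Kb) ∧ (w' i).Bounded KW Kb := fun i => by
      have := hw i
      rwa [hWb i] at this
    simp only [hWb, eval]
    refine (ih w' (fun i => (hB i).2) _).trans ?_
    have h1 : rad (fun i k j => ρ (((W i).mulVec (v i k) + b i) j))
        ≤ KW * rad v + Kb * √n + 1 / 2 * √n := by
      have e : (fun i k j => ρ (((W i).mulVec (v i k) + b i) j))
          = fun i (k : Fin n) => (fun j => ρ (((W i).mulVec (v i k) + b i) j) - 1 / 2)
            + fun _ => (1 / 2 : ℝ) := by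
        funext i k j
        simp
      rw [e]
      refine (rad_add_le _ _).trans (add_le_add ?_ ?_)
      · exact (rad_map_le_rad_of_odd (fun t => ρ t - 1 / 2) hρ.lipschitz_sub hρ.odd_sub
          fun i k => (W i).mulVec (v i k) + b i).trans
          (rad_affine_le W b v hKW hKb (fun i => (hB i).1.1.le) fun i => (hB i).1.2.le)
      · refine rad_const_le _ (by norm_num) fun i => ?_
        refine (pi_norm_le_iff_of_nonneg (by norm_num)).2 fun j => ?_
        norm_num
    calc _ ≤ KW ^ (M + 1) * (KW * rad v + Kb * √n + 1 / 2 * √n)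
          + (Kb + 1 / 2) * (∑ q ∈ Finset.range (M + 1), KW ^ q) * √n := by
          gcongr
      _ = _ := by
          rw [Finset.sum_range_succ _ (M + 1)]
          ring

end MLPWeights

/-! #### Gated linear units -/

lemma rad_gelu_le {I : Type*} [Finite I] {n : ℕ} {m : I → ℕ}
    (v : (i : I) → Fin n → Fin (m i) → ℝ) :
    rad (fun i k j => gelu (v i k j)) ≤ 4 * rad v := by
  have e : (fun i k j => gelu (v i k j)) = fun i k => (2 : ℝ) • fun j => gelu (v i k j) / 2 := by
    funext i k j
    simp only [Pi.smul_apply, smul_eq_mul]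
    ring
  have hl : LipschitzWith 1 fun t => gelu t / 2 := by
    refine LipschitzWith.of_dist_le_mul fun x y => ?_
    have := lipschitzWith_gelu.dist_le_mul x y
    rw [Real.dist_eq] at this ⊢
    rw [← sub_div, abs_div, abs_two]
    push_cast at this ⊢
    linarith
  have h := rad_map_le_two_mul_rad (fun t => gelu t / 2) hl (by simp [gelu_zero]) v
  rw [e]
  refine (rad_smul_le _ 2).trans ?_
  rw [abs_two]
  linarith

lemma rad_sq_le {I : Type*} [Finite I] {n : ℕ} {m : I → ℕ}
    (v : (i : I) → Fin n → Fin (m i) → ℝ) {B : ℝ} (hB : 0 < B) (hv : ∀ i k j, |v i k j| ≤ B) :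
    rad (fun i k j => v i k j ^ 2) ≤ 4 * B * rad v := by
  have e : (fun i k j => v i k j ^ 2)
      = fun i k => (2 * B) • fun j => v i k j ^ 2 / (2 * B) := by
    funext i k j
    simp only [Pi.smul_apply, smul_eq_mul]
    field_simp
  have h : rad (fun i k j => v i k j ^ 2 / (2 * B)) ≤ 2 * rad v := by
    rw [rad_pi, rad_pi v]
    refine rad_le_two_mul_rad _ _ (fun k p q => ?_) fun k p => ?_
    · have h1 := hv p.1 k p.2
      have h2 := hv q.1 k q.2
      rw [← sub_div, sq_sub_sq, abs_div, abs_mul, abs_of_pos (by positivity : 0 < 2 * B),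
        div_le_iff₀ (by positivity), mul_comm]
      exact mul_le_mul_of_nonneg_left ((abs_add_le _ _).trans (by linarith)) (abs_nonneg _)
    · have h1 := hv p.1 k p.2
      rw [abs_div, abs_pow, abs_of_pos (by positivity : 0 < 2 * B), div_le_iff₀ (by positivity),
        sq]
      exact mul_le_mul_of_nonneg_left (by linarith) (abs_nonneg _)
  rw [e]
  refine (rad_smul_le _ (2 * B)).trans ?_
  rw [abs_of_pos (by positivity)]
  nlinarith

/-- Products by polarisation: `4 r p q = (p + r q)² - (p - r q)²`, and squares of bounded
quantities are Lipschitz. -/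
lemma rad_mul_le {I : Type*} [Finite I] {n : ℕ} {m : I → ℕ}
    (p q : (i : I) → Fin n → Fin (m i) → ℝ) {r : ℝ} (hr : 0 < r)
    (hp : ∀ i k j, |p i k j| ≤ r) (hq : ∀ i k j, |q i k j| ≤ 1 / 2) :
    rad (fun i k j => p i k j * q i k j) ≤ 3 * rad p + 3 * r * rad q := by
  have hrq : ∀ i k j, |r * q i k j| ≤ r / 2 := fun i k j => by
    rw [abs_mul, abs_of_pos hr]
    nlinarith [hq i k j]
  have e : (fun i k j => p i k j * q i k j)
      = fun i k => (1 / (4 * r)) • (fun j => (p i k + r • q i k) j ^ 2)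
        + (-(1 / (4 * r))) • fun j => (p i k + (-r) • q i k) j ^ 2 := by
    funext i k j
    simp only [Pi.add_apply, Pi.smul_apply, smul_eq_mul]
    field_simp
    ring
  have h1 := rad_sq_le (fun i k => p i k + r • q i k) (B := 3 / 2 * r) (by positivity)
    fun i k j => by
      have h1 := hp i k j
      have h2 := hrq i k j
      simp only [Pi.add_apply, Pi.smul_apply, smul_eq_mul]
      exact (abs_add_le _ _).trans (by linarith)
  have h2 := rad_sq_le (fun i k => p i k + (-r) • q i k) (B := 3 / 2 * r) (by positivity)
    fun i k j => by
      have h1 := hp i k j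
      have h2 := hrq i k j
      simp only [Pi.add_apply, Pi.smul_apply, smul_eq_mul, neg_mul]
      refine (abs_add_le _ _).trans ?_
      rw [abs_neg]
      linarith
  have h3 : rad (fun i k => p i k + r • q i k) ≤ rad p + r * rad q := by
    refine (rad_add_le p fun i k => r • q i k).trans (add_le_add_right ?_ _)
    simpa [abs_of_pos hr] using rad_smul_le q r
  have h4 : rad (fun i k => p i k + (-r) • q i k) ≤ rad p + r * rad q := by
    refine (rad_add_le p fun i k => (-r) • q i k).trans (add_le_add_right ?_ _)
    simpa [abs_of_pos hr] using rad_smul_le q (-r)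
  rw [e]
  refine (rad_add_le _ _).trans ?_
  have h5 := rad_smul_le (fun i k j => (p i k + r • q i k) j ^ 2) (1 / (4 * r))
  have h6 := rad_smul_le (fun i k j => (p i k + (-r) • q i k) j ^ 2) (-(1 / (4 * r)))
  rw [abs_neg] at h6
  rw [abs_of_pos (by positivity : 0 < 1 / (4 * r))] at h5 h6
  calc _ ≤ 1 / (4 * r) * (4 * (3 / 2 * r) * (rad p + r * rad q))
        + 1 / (4 * r) * (4 * (3 / 2 * r) * (rad p + r * rad q)) := by
        refine add_le_add (h5.trans ?_) (h6.trans ?_)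
        · gcongr
          exact h1.trans (by gcongr)
        · gcongr
          exact h2.trans (by gcongr)
    _ = 3 * rad p + 3 * r * rad q := by
        field_simp
        ring

/-- The gate is split as `σ = 1/2 + (σ - 1/2)`, so that no constant term appears: every summand
of the output is a product with a `GELU` factor. -/
lemma rad_glu_le {σ : ℝ → ℝ} (hσ : IsSigmoid σ) {I : Type*} [Finite I] {n m : ℕ} {K r : ℝ}
    (hK : 0 ≤ K) (hr : 0 ≤ r) (W : I → Matrix (Fin m) (Fin m) ℝ) (hW : ∀ i, opNormInf (W i) ≤ K)
    (v : I → Fin n → Fin m → ℝ) (hv : ∀ i k, ‖v i k‖ ≤ r) :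
    rad (fun i k j => gelu (v i k j) * σ ((W i).mulVec (fun l => gelu (v i k l)) j))
      ≤ 16 * (r * (K + 1) ^ 2 + (K + 1)) * rad v := by
  let p : I → Fin n → Fin m → ℝ := fun i k j => gelu (v i k j)
  let q : I → Fin n → Fin m → ℝ := fun i k j => σ ((W i).mulVec (p i k) j) - 1 / 2
  have e : (fun i k j => gelu (v i k j) * σ ((W i).mulVec (fun l => gelu (v i k l)) j))
      = fun i k => (1 / 2 : ℝ) • p i k + fun j => p i k j * q i k j := by
    funext i k j
    simp only [Pi.add_apply, Pi.smul_apply, smul_eq_mul, p, q]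
    ring
  have hR := rad_nonneg v
  have hp : rad p ≤ 4 * rad v := rad_gelu_le v
  have hq : rad q ≤ K * rad p :=
    (rad_map_le_rad_of_odd (fun t => σ t - 1 / 2) hσ.lipschitz_sub hσ.odd_sub
      fun i k => (W i).mulVec (p i k)).trans (rad_mulVec_le W p hK hW)
  -- the radius `r + 1` is positive even if `r = 0`
  have hpq := rad_mul_le p q (r := r + 1) (by positivity)
    (fun i k j => (abs_gelu_le _).trans
      (((norm_le_pi_norm (v i k) j).trans (hv i k)).trans (by linarith)))
    fun i k j => hσ.abs_sub_le _
  have hs := rad_smul_le p (1 / 2)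
  rw [abs_of_pos (by norm_num : (0 : ℝ) < 1 / 2)] at hs
  rw [e]
  refine (rad_add_le (fun i k => (1 / 2 : ℝ) • p i k) fun i k j => p i k j * q i k j).trans ?_
  have hq' : rad q ≤ K * (4 * rad v) := hq.trans (by gcongr)
  calc _ ≤ 1 / 2 * (4 * rad v) + (3 * (4 * rad v) + 3 * (r + 1) * (K * (4 * rad v))) := by
        refine add_le_add (hs.trans (by gcongr)) (hpq.trans ?_)
        gcongr
    _ = (14 + 12 * K + 12 * (r * K)) * rad v := by ring
    _ ≤ 16 * (r * (K + 1) ^ 2 + (K + 1)) * rad v := by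
        have := mul_nonneg hr hK
        have := mul_nonneg hr (sq_nonneg K)
        gcongr
        nlinarith

/-! #### Layer classes -/

namespace LayerClass

variable {ny nu : ℕ} {cl : LayerClass}

lemma continuous_eval (hcl : cl.Valid) {g : NonlinearLayer ny nu} (hg : cl.Admits g) :
    Continuous g.eval := by
  cases cl with
  | reluMLP M KW Kb =>
    obtain ⟨w, rfl, -⟩ := hg
    exact w.continuous_eval lipschitzWith_relu.continuous
  | sigmoidMLP ρ M KW Kb =>
    obtain ⟨w, rfl, -⟩ := hg
    exact w.continuous_eval hcl.1.lipschitz.continuous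
  | glu σ K =>
    obtain ⟨h, W, rfl, -⟩ := hg
    have hc := lipschitzWith_gelu.continuous
    have hs := (show IsSigmoid σ from hcl).lipschitz.continuous
    have hv : Continuous fun v : Fin ny → ℝ => W.mulVec (fun l => gelu (v l)) := by fun_prop
    exact continuous_pi fun j => (hc.comp (continuous_apply _)).mul
      (hs.comp ((continuous_apply j).comp hv))

lemma norm_eval_le (hcl : cl.Valid) {g : NonlinearLayer ny nu} (hg : cl.Admits g) {r : ℝ}
    {v : Fin ny → ℝ} (hv : ‖v‖ ≤ r) : ‖g.eval v‖ ≤ cl.rhat r := by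
  cases cl with
  | reluMLP M KW Kb =>
    obtain ⟨w, rfl, hw⟩ := hg
    exact w.norm_eval_relu_le hw hv
  | sigmoidMLP ρ M KW Kb =>
    obtain ⟨w, rfl, hw⟩ := hg
    have hM : 1 ≤ M := hcl.2
    exact w.norm_eval_sigmoid_le hcl.1 hw fun h => by omega
  | glu σ K =>
    obtain ⟨h, W, rfl, -⟩ := hg
    have hs : IsSigmoid σ := hcl
    have hr : 0 ≤ r := (norm_nonneg _).trans hv
    refine (pi_norm_le_iff_of_nonneg hr).2 fun j => ?_
    simp only [NonlinearLayer.eval, norm_mul, Real.norm_eq_abs]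
    exact (mul_le_of_le_one_right (abs_nonneg _) (hs.abs_le_one _)).trans
      ((abs_gelu_le _).trans ((norm_le_pi_norm v _).trans hv))

lemma mu_nonneg {g : NonlinearLayer ny nu} (hg : cl.Admits g) {r : ℝ} (hr : 0 ≤ r) :
    0 ≤ cl.mu r := by
  cases cl with
  | reluMLP M KW Kb =>
    obtain ⟨w, rfl, hw⟩ := hg
    have := hw.pos.1
    simp only [mu]
    positivity
  | sigmoidMLP ρ M KW Kb =>
    obtain ⟨w, rfl, hw⟩ := hg
    have := hw.pos.1
    simp only [mu]
    positivity
  | glu σ K =>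
    obtain ⟨h, W, rfl, hW⟩ := hg
    have := (opNormInf_nonneg W).trans_lt hW
    simp only [mu]
    positivity

/-- A nonlinear layer applied to inputs of size at most `r` maps Rademacher averages with
slope `μ(r)` and offset `c(r) √n`. -/
theorem rad_eval_le (hcl : cl.Valid) {I : Type*} [Finite I] [Nonempty I] {n : ℕ} {r : ℝ} (hr : 0 ≤ r)
    (g : I → NonlinearLayer ny nu) (hg : ∀ i, cl.Admits (g i)) (v : I → Fin n → Fin ny → ℝ)
    (hv : ∀ i k, ‖v i k‖ ≤ r) :
    rad (fun i k => (g i).eval (v i k)) ≤ cl.mu r * rad v + cl.c r * √n := by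
  cases cl with
  | reluMLP M KW Kb =>
    choose w hw hB using hg
    have hpos := (hB (Classical.arbitrary I)).pos
    obtain rfl : g = fun i => .mlp relu M (w i) := funext hw
    exact MLPWeights.rad_eval_relu_le hpos.1.le hpos.2.le w hB v
  | sigmoidMLP ρ M KW Kb =>
    choose w hw hB using hg
    have hpos := (hB (Classical.arbitrary I)).pos
    obtain rfl : g = fun i => .mlp ρ M (w i) := funext hw
    exact MLPWeights.rad_eval_sigmoid_le hcl.1 hpos.1.le hpos.2.le w hB v
  | glu σ K =>
    choose h W hw hB using hg
    obtain rfl := h (Classical.arbitrary I)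
    have hK := (opNormInf_nonneg (W (Classical.arbitrary I))).trans (hB _).le
    obtain rfl : g = fun i => .glu rfl σ (W i) := funext hw
    have := rad_glu_le (show IsSigmoid σ from hcl) hK hr W (fun i => (hB i).le) v hv
    simpa [NonlinearLayer.eval, mu, c] using this

end LayerClass

/-! ### Linear layers: encoder, state-space models, pooling -/

namespace TSeq

variable {T n : ℕ}

/-- The extension of a finite sequence by zero. -/
def extend (u : TSeq T n) (k : ℕ) : Fin n → ℝ := if h : k < T then u ⟨k, h⟩ else 0

lemma extend_val (u : TSeq T n) (k : Fin T) : u.extend k = u k := by simp [extend]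

lemma extend_add (u v : TSeq T n) (k : ℕ) : extend (u + v) k = extend u k + extend v k := by
  unfold extend
  split_ifs <;> simp

lemma extend_smul (c : ℝ) (u : TSeq T n) (k : ℕ) : extend (c • u) k = c • extend u k := by
  unfold extend
  split_ifs <;> simp

lemma norm_extend_le (u : TSeq T n) (k : ℕ) : ‖u.extend k‖ ≤ ‖u‖ := by
  unfold extend
  split_ifs
  · exact norm_le_pi_norm u _
  · simp

lemma l2Norm_nonneg (u : TSeq T n) : 0 ≤ u.l2Norm := Real.sqrt_nonneg _

lemma sq_l2Norm (u : TSeq T n) : u.l2Norm ^ 2 = ∑ k, ∑ j, u k j ^ 2 :=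
  Real.sq_sqrt (Finset.sum_nonneg fun _ _ => Finset.sum_nonneg fun _ _ => sq_nonneg _)

lemma norm_le_l2Norm (u : TSeq T n) : ‖u‖ ≤ u.l2Norm := by
  refine (pi_norm_le_iff_of_nonneg u.l2Norm_nonneg).2 fun k =>
    (pi_norm_le_iff_of_nonneg u.l2Norm_nonneg).2 fun j => Real.abs_le_sqrt ?_
  refine (Finset.single_le_sum (f := fun j => u k j ^ 2) (fun j _ => sq_nonneg _)
    (Finset.mem_univ j)).trans ?_
  exact Finset.single_le_sum (f := fun k => ∑ j, u k j ^ 2)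
    (fun k _ => Finset.sum_nonneg fun j _ => sq_nonneg _) (Finset.mem_univ k)

end TSeq

lemma sum_sq_mulVec_le {m n : ℕ} (W : Matrix (Fin m) (Fin n) ℝ) (x : Fin n → ℝ) :
    ∑ j, W.mulVec x j ^ 2 ≤ opNormTwo W ^ 2 * ∑ j, x j ^ 2 := by
  have h := (LinearMap.toContinuousLinearMap (Matrix.toLpLin 2 2 W)).le_opNorm (WithLp.toLp 2 x)
  have h2 := pow_le_pow_left₀ (norm_nonneg _) h 2
  rw [mul_pow, EuclideanSpace.norm_sq_eq, EuclideanSpace.norm_sq_eq] at h2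
  simpa [opNormTwo] using h2

lemma opNormTwo_nonneg {m n : ℕ} (W : Matrix (Fin m) (Fin n) ℝ) : 0 ≤ opNormTwo W := norm_nonneg _

lemma l2Norm_mulVec_le {T m n : ℕ} (W : Matrix (Fin m) (Fin n) ℝ) (u : TSeq T n) :
    TSeq.l2Norm (fun k => W.mulVec (u k)) ≤ opNormTwo W * u.l2Norm := by
  refine Real.sqrt_le_iff.2 ⟨mul_nonneg (opNormTwo_nonneg W) u.l2Norm_nonneg, ?_⟩
  rw [mul_pow, TSeq.sq_l2Norm, Finset.mul_sum]
  exact Finset.sum_le_sum fun k _ => sum_sq_mulVec_le W (u k)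

namespace SSM

variable {nu ny T : ℕ} (s : SSM nu ny)

/-- The impulse response: `D, CB, CAB, CA²B, …`. -/
def markov : ℕ → Matrix (Fin ny) (Fin nu) ℝ
  | 0 => s.D
  | j + 1 => s.C * s.A ^ j * s.B

lemma state_eq (u : TSeq T nu) (k : ℕ) :
    s.state u k = ∑ j ∈ Finset.range k, (s.A ^ j * s.B).mulVec (u.extend (k - 1 - j)) := by
  induction k with
  | zero => rfl
  | succ k ih =>
    rw [Finset.sum_range_succ']
    have h : s.state u (k + 1) = s.A.mulVec (s.state u k) + s.B.mulVec (u.extend k) := rfl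
    rw [h, ih, Matrix.mulVec_sum]
    congr 1
    · refine Finset.sum_congr rfl fun j _ => ?_
      rw [Matrix.mulVec_mulVec, ← Matrix.mul_assoc, ← pow_succ']
      congr 2
      omega
    · simp

/-- The input-output map is the convolution with the impulse response. -/
lemma ioMap_eq (u : TSeq T nu) (k : Fin T) :
    s.ioMap u k
      = ∑ j ∈ Finset.range ((k : ℕ) + 1), (s.markov j).mulVec (u.extend ((k : ℕ) - j)) := by
  rw [Finset.sum_range_succ', ioMap, state_eq, Matrix.mulVec_sum]
  congr 1
  · refine Finset.sum_congr rfl fun j _ => ?_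
    rw [Matrix.mulVec_mulVec, ← Matrix.mul_assoc, markov]
    congr 2
    omega
  · simp [markov, TSeq.extend_val]

/-- The input-output map as a linear map. -/
def ioLin (T : ℕ) : TSeq T nu →ₗ[ℝ] TSeq T ny where
  toFun := s.ioMap
  map_add' u v := by
    funext k
    simp [ioMap_eq, TSeq.extend_add, Matrix.mulVec_add, Finset.sum_add_distrib]
  map_smul' c u := by
    funext k
    simp only [ioMap_eq, TSeq.extend_smul, Matrix.mulVec_smul, RingHom.id_apply, Pi.smul_apply,
      Finset.smul_sum]

lemma continuous_ioMap : Continuous (s.ioMap (T := T)) :=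
  (s.ioLin T).continuous_of_finiteDimensional

lemma ioMap_sum_smul {N : ℕ} (c : Fin N → ℝ) (u : Fin N → TSeq T nu) :
    ∑ k, c k • s.ioMap (u k) = s.ioMap (∑ k, c k • u k) := by
  have h := map_sum (s.ioLin T) (fun k => c k • u k) Finset.univ
  simp only [map_smul] at h
  exact h.symm

variable {s}

lemma sum_abs_markov_le {K : ℝ} (hK : 0 ≤ K) (h : s.l1Norm ≤ ENNReal.ofReal K) (i : Fin ny)
    (n : ℕ) : ∑ j ∈ Finset.range (n + 1), ∑ l, |s.markov j i l| ≤ K := by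
  have hn : ∀ j, 0 ≤ ∑ l, |s.markov j i l| := fun j => Finset.sum_nonneg fun l _ => abs_nonneg _
  rw [← ENNReal.ofReal_le_ofReal_iff hK, Finset.sum_range_succ', add_comm,
    ENNReal.ofReal_add (hn 0) (Finset.sum_nonneg fun j _ => hn (j + 1)),
    ENNReal.ofReal_sum_of_nonneg fun j _ => hn (j + 1)]
  refine le_trans ?_ ((le_iSup (fun i : Fin ny => ENNReal.ofReal (∑ j, |s.D i j|)
    + ∑' k : ℕ, ENNReal.ofReal (∑ j, |(s.C * s.A ^ k * s.B) i j|)) i).trans h)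
  exact add_le_add le_rfl (ENNReal.sum_le_tsum _)

lemma sum_sq_markov_le {K : ℝ} (hK : 0 ≤ K) (h : s.h2Norm ≤ ENNReal.ofReal K) (n : ℕ) :
    ∑ j ∈ Finset.range (n + 1), ∑ i, ∑ l, s.markov j i l ^ 2 ≤ K ^ 2 := by
  have hn : ∀ j, 0 ≤ ∑ i, ∑ l, s.markov j i l ^ 2 := fun j =>
    Finset.sum_nonneg fun i _ => Finset.sum_nonneg fun l _ => sq_nonneg _
  have h2 := ENNReal.rpow_le_rpow h (zero_le_two (α := ℝ))
  rw [h2Norm, ← ENNReal.rpow_mul, ENNReal.ofReal_rpow_of_nonneg hK zero_le_two] at h2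
  norm_num at h2
  rw [← ENNReal.ofReal_le_ofReal_iff (sq_nonneg K), Finset.sum_range_succ', add_comm,
    ENNReal.ofReal_add (hn 0) (Finset.sum_nonneg fun j _ => hn (j + 1)),
    ENNReal.ofReal_sum_of_nonneg fun j _ => hn (j + 1)]
  exact le_trans (add_le_add le_rfl (ENNReal.sum_le_tsum _)) h2

/-- `‖Σ‖₁` bounds the gain from `ℓ^∞` to `ℓ^∞`. -/
lemma norm_ioMap_le {K : ℝ} (hK : 0 ≤ K) (h : s.l1Norm ≤ ENNReal.ofReal K) (u : TSeq T nu) :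
    ‖s.ioMap u‖ ≤ K * ‖u‖ := by
  have h0 := mul_nonneg hK (norm_nonneg u)
  refine (pi_norm_le_iff_of_nonneg h0).2 fun k => (pi_norm_le_iff_of_nonneg h0).2 fun i => ?_
  rw [ioMap_eq, Finset.sum_apply]
  calc ‖∑ j ∈ Finset.range ((k : ℕ) + 1), (s.markov j).mulVec (u.extend ((k : ℕ) - j)) i‖
      ≤ ∑ j ∈ Finset.range ((k : ℕ) + 1), (∑ l, |s.markov j i l|) * ‖u‖ := by
        refine norm_sum_le_of_le _ fun j _ => ?_
        rw [Matrix.mulVec, dotProduct, Finset.sum_mul]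
        refine norm_sum_le_of_le _ fun l _ => ?_
        rw [norm_mul, Real.norm_eq_abs]
        exact mul_le_mul_of_nonneg_left
          ((norm_le_pi_norm _ l).trans (TSeq.norm_extend_le u _)) (abs_nonneg _)
    _ = (∑ j ∈ Finset.range ((k : ℕ) + 1), ∑ l, |s.markov j i l|) * ‖u‖ := by
        rw [Finset.sum_mul]
    _ ≤ K * ‖u‖ := by
        gcongr
        exact sum_abs_markov_le hK h i k

/-- `‖Σ‖₂` bounds the gain from `ℓ²` to `ℓ^∞`, by the Cauchy-Schwarz inequality. -/
lemma norm_ioMap_le_l2Norm {K : ℝ} (hK : 0 ≤ K) (h : s.h2Norm ≤ ENNReal.ofReal K)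
    (u : TSeq T nu) : ‖s.ioMap u‖ ≤ K * u.l2Norm := by
  have h0 := mul_nonneg hK u.l2Norm_nonneg
  refine (pi_norm_le_iff_of_nonneg h0).2 fun k => (pi_norm_le_iff_of_nonneg h0).2 fun i => ?_
  rw [ioMap_eq, Finset.sum_apply, Real.norm_eq_abs]
  refine abs_le_of_sq_le_sq ?_ h0
  have e : ∑ j ∈ Finset.range ((k : ℕ) + 1), (s.markov j).mulVec (u.extend ((k : ℕ) - j)) i
      = ∑ p ∈ Finset.range ((k : ℕ) + 1) ×ˢ (Finset.univ : Finset (Fin nu)),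
        s.markov p.1 i p.2 * u.extend ((k : ℕ) - p.1) p.2 := by
    rw [Finset.sum_product]
    rfl
  rw [e, mul_pow, TSeq.sq_l2Norm]
  refine (Finset.sum_mul_sq_le_sq_mul_sq _ _ _).trans (mul_le_mul ?_ ?_ ?_ (sq_nonneg K))
  · rw [Finset.sum_product]
    refine le_trans (Finset.sum_le_sum fun j _ => ?_) (sum_sq_markov_le hK h k)
    exact Finset.single_le_sum (f := fun i => ∑ l, s.markov j i l ^ 2)
      (fun i _ => Finset.sum_nonneg fun l _ => sq_nonneg _) (Finset.mem_univ i)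
  · rw [Finset.sum_product]
    have hr := Finset.sum_range_reflect (fun j => ∑ l, u.extend j l ^ 2) ((k : ℕ) + 1)
    have e2 : ∑ k, ∑ j, u k j ^ 2 = ∑ j ∈ Finset.range T, ∑ l, u.extend j l ^ 2 := by
      rw [← Fin.sum_univ_eq_sum_range (fun j => ∑ l, u.extend j l ^ 2)]
      simp only [TSeq.extend_val]
    simp only [Nat.add_sub_cancel] at hr
    rw [hr, e2]
    refine Finset.sum_le_sum_of_subset_of_nonneg ?_
      fun j _ _ => Finset.sum_nonneg fun l _ => sq_nonneg _
    exact Finset.range_subset_range.2 k.2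
  · exact Finset.sum_nonneg fun p _ => sq_nonneg _

end SSM

lemma norm_pool_le {T n : ℕ} (u : TSeq T n) : ‖pool u‖ ≤ ‖u‖ := by
  rw [pool, norm_smul, norm_inv, Real.norm_natCast]
  have h : ‖∑ k, u k‖ ≤ T * ‖u‖ := by
    refine (norm_sum_le_of_le _ fun k _ => norm_le_pi_norm u k).trans (le_of_eq ?_)
    simp
  rcases Nat.eq_zero_or_pos T with rfl | hT
  · simp
  · rw [inv_mul_le_iff₀ (by exact_mod_cast hT)]
    exact h

lemma pool_sum_smul {T n N : ℕ} (c : Fin N → ℝ) (u : Fin N → TSeq T n) :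
    ∑ k, c k • pool (u k) = pool (∑ k, c k • u k) := by
  simp only [pool, Finset.sum_apply, Pi.smul_apply]
  rw [Finset.sum_comm, Finset.smul_sum]
  refine Finset.sum_congr rfl fun k _ => ?_
  rw [smul_comm, Finset.smul_sum]

/-! ### Deep models -/

namespace DeepSSM

variable {nin nu ny : ℕ} {P : BoundData}

/-- The model `f` obeys the bounds collected in `P`. -/
structure Conforms (P : BoundData) (f : DeepSSM P.L nin nu ny 1) : Prop where
  K1_nonneg : 0 ≤ P.K1
  K2_nonneg : 0 ≤ P.K2
  enc_lt : opNormTwo f.enc < P.KEnc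
  dec_lt : opNormInf f.dec < P.KDec
  l1Norm_le : ∀ i, (f.block i).ssm.l1Norm ≤ ENNReal.ofReal P.K1
  h2Norm_le : ∀ i, (f.block i).ssm.h2Norm ≤ ENNReal.ofReal P.K2
  res_eq : ∀ i : Fin P.L, (f.block i).res = P.res i
  valid : ∀ i : Fin P.L, (P.cls i).Valid
  admits : ∀ i : Fin P.L, (P.cls i).Admits (f.block i).layer

variable {T : ℕ} {f : DeepSSM P.L nin nu ny 1}

lemma hidden_succ (f : DeepSSM P.L nin nu ny 1) (u : TSeq T nin) {i : ℕ} (hi : i < P.L) :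
    f.hidden u (i + 1) = fun k => (f.block ⟨i, hi⟩).layer.eval
      ((f.block ⟨i, hi⟩).ssm.ioMap (f.hidden u i) k)
        + (f.block ⟨i, hi⟩).res • f.hidden u i k := by
  rw [hidden, dif_pos hi]
  rfl

namespace Conforms

lemma KEnc_nonneg (hf : f.Conforms P) : 0 ≤ P.KEnc := (opNormTwo_nonneg _).trans hf.enc_lt.le

lemma KDec_nonneg (hf : f.Conforms P) : 0 ≤ P.KDec := (opNormInf_nonneg _).trans hf.dec_lt.le

lemma gain_nonneg (hf : f.Conforms P) (i : ℕ) : 0 ≤ P.gain i := by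
  cases i
  · exact hf.K2_nonneg
  · exact hf.K1_nonneg

lemma continuous_hidden (hf : f.Conforms P) {i : ℕ} (hi : i ≤ P.L) :
    Continuous fun u : TSeq T nin => f.hidden u i := by
  induction i with
  | zero =>
    refine continuous_pi fun k => ?_
    have : Continuous fun u : TSeq T nin => f.enc.mulVec (u k) := by fun_prop
    exact this
  | succ i ih =>
    have h := ih (by omega)
    simp only [fun u => f.hidden_succ (T := T) u (show i < P.L from hi)]
    refine continuous_pi fun k => Continuous.add ?_ ?_
    · exact (LayerClass.continuous_eval (hf.valid ⟨i, hi⟩) (hf.admits ⟨i, hi⟩)).comp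
        ((continuous_apply k).comp ((SSM.continuous_ioMap _).comp h))
    · exact ((continuous_apply k).comp h).const_smul (f.block ⟨i, hi⟩).res

lemma continuous_eval (hf : f.Conforms P) :
    Continuous fun u : TSeq T nin => f.eval u 0 := by
  have h := hf.continuous_hidden (T := T) le_rfl
  have h' : Continuous fun u : TSeq T nin => f.dec.mulVec (pool (f.hidden u P.L)) := by
    unfold pool
    fun_prop
  exact (continuous_apply 0).comp h'

lemma l2Norm_hidden_zero_le (hf : f.Conforms P) {u : TSeq T nin} (hu : u.l2Norm ≤ P.Ku) :
    (f.hidden u 0).l2Norm ≤ P.radius 0 :=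
  (l2Norm_mulVec_le f.enc u).trans
    (mul_le_mul hf.enc_lt.le hu u.l2Norm_nonneg hf.KEnc_nonneg)

lemma norm_ioMap_hidden_le (hf : f.Conforms P) {u : TSeq T nin} (hu : u.l2Norm ≤ P.Ku) {i : ℕ}
    (hi : i < P.L) (h : ‖f.hidden u i‖ ≤ P.radius i) :
    ‖(f.block ⟨i, hi⟩).ssm.ioMap (f.hidden u i)‖ ≤ P.gain i * P.radius i := by
  cases i with
  | zero =>
    exact (SSM.norm_ioMap_le_l2Norm hf.K2_nonneg (hf.h2Norm_le _) _).trans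
      (mul_le_mul_of_nonneg_left (hf.l2Norm_hidden_zero_le hu) hf.K2_nonneg)
  | succ i =>
    exact (SSM.norm_ioMap_le hf.K1_nonneg (hf.l1Norm_le _) _).trans
      (mul_le_mul_of_nonneg_left h hf.K1_nonneg)

lemma norm_hidden_le (hT : 0 < T) (hf : f.Conforms P) {u : TSeq T nin} (hu : u.l2Norm ≤ P.Ku) {i : ℕ}
    (hi : i ≤ P.L) : ‖f.hidden u i‖ ≤ P.radius i := by
  induction i with
  | zero => exact (TSeq.norm_le_l2Norm _).trans (hf.l2Norm_hidden_zero_le hu)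
  | succ i ih =>
    have h := ih (by omega)
    have hio := hf.norm_ioMap_hidden_le hu hi h
    have hk : ∀ k, ‖f.hidden u (i + 1) k‖ ≤ P.radius (i + 1) := fun k => by
      rw [f.hidden_succ u hi]
      refine (norm_add_le _ _).trans (add_le_add ?_ ?_)
      · exact LayerClass.norm_eval_le (hf.valid ⟨i, hi⟩) (hf.admits ⟨i, hi⟩)
          ((norm_le_pi_norm _ k).trans hio)
      · rw [norm_smul, hf.res_eq, Real.norm_eq_abs]
        exact mul_le_mul_of_nonneg_left ((norm_le_pi_norm _ k).trans h) (abs_nonneg _)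
    exact (pi_norm_le_iff_of_nonneg ((norm_nonneg _).trans (hk ⟨0, hT⟩))).2 hk

lemma radius_nonneg (hT : 0 < T) (hf : f.Conforms P) (hKu : 0 ≤ P.Ku) {i : ℕ} (hi : i ≤ P.L) :
    0 ≤ P.radius i :=
  (norm_nonneg _).trans (hf.norm_hidden_le hT (u := 0) (by simpa [TSeq.l2Norm] using hKu) hi)

lemma abs_eval_le (hT : 0 < T) (hf : f.Conforms P) {u : TSeq T nin} (hu : u.l2Norm ≤ P.Ku) :
    |f.eval u 0| ≤ P.KDec * P.radius P.L :=
  (norm_le_pi_norm (f.eval u) 0).trans ((norm_mulVec_le _ _).trans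
    (mul_le_mul hf.dec_lt.le ((norm_pool_le _).trans (hf.norm_hidden_le hT hu le_rfl))
      (norm_nonneg _) hf.KDec_nonneg))

end Conforms

end DeepSSM

namespace BoundData

variable (P : BoundData)

/-- The bound on the Rademacher average of the input of the block with index `i`, in units of
`√N`. -/
def radBound : ℕ → ℝ
  | 0 => P.KEnc * P.Ku
  | i + 1 => P.factor i * radBound i + (P.cls i).c (P.gain i * P.radius i)

lemma radBound_eq (n : ℕ) : P.radBound n = P.KEnc * P.Ku * ∏ i ∈ Finset.range n, P.factor i
    + ∑ j ∈ Finset.range n, (∏ i ∈ Finset.Ico (j + 1) n, P.factor i)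
      * (P.cls j).c (P.gain j * P.radius j) := by
  induction n with
  | zero => simp [radBound]
  | succ n ih =>
    rw [radBound, ih, Finset.prod_range_succ, Finset.sum_range_succ, Finset.Ico_self,
      Finset.prod_empty, mul_add, Finset.mul_sum]
    have h : ∀ j ∈ Finset.range n, (∏ i ∈ Finset.Ico (j + 1) (n + 1), P.factor i)
        * (P.cls j).c (P.gain j * P.radius j)
        = P.factor n * ((∏ i ∈ Finset.Ico (j + 1) n, P.factor i)
          * (P.cls j).c (P.gain j * P.radius j)) := fun j hj => by
      rw [Finset.prod_Ico_succ_top (by simpa using hj)]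
      ring
    rw [Finset.sum_congr rfl h]
    ring

lemma KDec_mul_radBound : P.KDec * P.radBound P.L = P.mu * P.Ku + P.c := by
  rw [radBound_eq, mu, c]
  ring

end BoundData

namespace DeepSSM

variable {nin nu ny T N : ℕ} {P : BoundData} {ι : Type*}
  {f : ι → DeepSSM P.L nin nu ny 1} {u : Fin N → TSeq T nin}

lemma signAvg_l2Norm_le {n : ℕ} (u : Fin N → TSeq T n) {K : ℝ} (hK : 0 ≤ K)
    (hu : ∀ k, (u k).l2Norm ≤ K) :
    signAvg N (fun s => TSeq.l2Norm (∑ k, s k • u k)) ≤ K * √N := by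
  have e : ∀ v : TSeq T n, v.l2Norm = √(∑ p : Fin T × Fin n, v p.1 p.2 ^ 2) := fun v => by
    rw [Fintype.sum_prod_type]
    rfl
  have h := signAvg_sqrt_sum_sq_le fun k (p : Fin T × Fin n) => u k p.1 p.2
  simp only [e, Finset.sum_apply, Pi.smul_apply, smul_eq_mul]
  refine h.trans (Real.sqrt_le_iff.2 ⟨by positivity, ?_⟩)
  have h2 : ∀ k, ∑ p : Fin T × Fin n, u k p.1 p.2 ^ 2 ≤ K ^ 2 := fun k => by
    rw [Fintype.sum_prod_type, ← TSeq.sq_l2Norm]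
    exact pow_le_pow_left₀ (TSeq.l2Norm_nonneg _) (hu k) 2
  refine (Finset.sum_le_sum fun k _ => h2 k).trans (le_of_eq ?_)
  simp [mul_pow, mul_comm]

/-- The first block reads the encoded input through its gain from `ℓ²` to `ℓ^∞`. The `ℓ²` norm of
the signed sums is controlled on average by a second moment, with no dependence on `T`. -/
lemma rad_ioMap_zero_le (hf : ∀ a, (f a).Conforms P) [Nonempty ι] (hKu : 0 ≤ P.Ku)
    (hu : ∀ k, (u k).l2Norm ≤ P.Ku) (h0 : 0 < P.L) :
    rad (fun a k => ((f a).block ⟨0, h0⟩).ssm.ioMap ((f a).hidden (u k) 0))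
      ≤ P.K2 * (P.KEnc * P.Ku * √N) := by
  have hc := hf (Classical.arbitrary ι)
  have h : rad (fun a k => ((f a).block ⟨0, h0⟩).ssm.ioMap ((f a).hidden (u k) 0))
      ≤ signAvg N (fun s => P.K2 * (P.KEnc * TSeq.l2Norm (∑ k, s k • u k))) := by
    refine rad_le_signAvg (fun s => mul_nonneg hc.K2_nonneg
      (mul_nonneg hc.KEnc_nonneg (TSeq.l2Norm_nonneg _))) fun s _ a => ?_
    rw [SSM.ioMap_sum_smul]
    refine (SSM.norm_ioMap_le_l2Norm (hf a).K2_nonneg ((hf a).h2Norm_le _) _).trans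
      (mul_le_mul_of_nonneg_left ?_ hc.K2_nonneg)
    have e : ∑ k, s k • (f a).hidden (u k) 0
        = fun t => (f a).enc.mulVec ((∑ k, s k • u k) t) := by
      funext t
      simp only [Finset.sum_apply, Pi.smul_apply, hidden]
      exact mulVec_sum_smul _ _ _
    rw [e]
    exact (l2Norm_mulVec_le _ _).trans
      (mul_le_mul_of_nonneg_right (hf a).enc_lt.le (TSeq.l2Norm_nonneg _))
  rw [signAvg_const_mul, signAvg_const_mul] at h
  refine h.trans (mul_le_mul_of_nonneg_left ?_ hc.K2_nonneg)
  rw [mul_assoc]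
  exact mul_le_mul_of_nonneg_left (signAvg_l2Norm_le u hKu hu) hc.KEnc_nonneg

lemma rad_hidden_zero_le (hf : ∀ a, (f a).Conforms P) [Nonempty ι] (hKu : 0 ≤ P.Ku)
    (hu : ∀ k, (u k).l2Norm ≤ P.Ku) :
    rad (fun a k => (f a).hidden (u k) 0) ≤ P.KEnc * P.Ku * √N := by
  have hc := hf (Classical.arbitrary ι)
  have h : rad (fun a k => (f a).hidden (u k) 0)
      ≤ signAvg N (fun s => P.KEnc * TSeq.l2Norm (∑ k, s k • u k)) := by
    refine rad_le_signAvg (fun s => mul_nonneg hc.KEnc_nonneg (TSeq.l2Norm_nonneg _))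
      fun s _ a => ?_
    have e : ∑ k, s k • (f a).hidden (u k) 0
        = fun t => (f a).enc.mulVec ((∑ k, s k • u k) t) := by
      funext t
      simp only [Finset.sum_apply, Pi.smul_apply, hidden]
      exact mulVec_sum_smul _ _ _
    rw [e]
    exact (TSeq.norm_le_l2Norm _).trans ((l2Norm_mulVec_le _ _).trans
      (mul_le_mul_of_nonneg_right (hf a).enc_lt.le (TSeq.l2Norm_nonneg _)))
  rw [signAvg_const_mul] at h
  rw [mul_assoc]
  exact h.trans (mul_le_mul_of_nonneg_left (signAvg_l2Norm_le u hKu hu) hc.KEnc_nonneg)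

lemma rad_ioMap_le [Finite ι] (hf : ∀ a, (f a).Conforms P) [Nonempty ι] (hKu : 0 ≤ P.Ku)
    (hu : ∀ k, (u k).l2Norm ≤ P.Ku) {i : ℕ} (hi : i < P.L)
    (h : rad (fun a k => (f a).hidden (u k) i) ≤ P.radBound i * √N) :
    rad (fun a k => ((f a).block ⟨i, hi⟩).ssm.ioMap ((f a).hidden (u k) i))
      ≤ P.gain i * (P.radBound i * √N) := by
  cases i with
  | zero => exact rad_ioMap_zero_le hf hKu hu hi
  | succ i =>
    have hc := hf (Classical.arbitrary ι)
    refine (rad_le_mul_rad _ (fun a k => (f a).hidden (u k) (i + 1)) hc.K1_nonneg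
      fun s a => ⟨a, ?_⟩).trans (mul_le_mul_of_nonneg_left h hc.K1_nonneg)
    rw [SSM.ioMap_sum_smul]
    exact SSM.norm_ioMap_le (hf a).K1_nonneg ((hf a).l1Norm_le _) _

/-- The Rademacher average after `i` blocks, by induction: block `i` multiplies it by at most
`factor i` and adds the offset of its nonlinear layer. -/
lemma rad_hidden_le [Finite ι] (hT : 0 < T) (hf : ∀ a, (f a).Conforms P) [Nonempty ι] (hKu : 0 ≤ P.Ku)
    (hu : ∀ k, (u k).l2Norm ≤ P.Ku) {i : ℕ} (hi : i ≤ P.L) :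
    rad (fun a k => (f a).hidden (u k) i) ≤ P.radBound i * √N := by
  have hc := hf (Classical.arbitrary ι)
  induction i with
  | zero => exact rad_hidden_zero_le hf hKu hu
  | succ i ih =>
    have hR := ih (by omega)
    have hio := rad_ioMap_le hf hKu hu hi hR
    have hr : 0 ≤ P.gain i * P.radius i := by
      exact mul_nonneg (hc.gain_nonneg i) (hc.radius_nonneg hT hKu (by omega))
    have hμ := LayerClass.mu_nonneg (hc.admits ⟨i, hi⟩) hr
    have : Nonempty (Σ _ : ι, Fin T) := ⟨⟨Classical.arbitrary ι, ⟨0, hT⟩⟩⟩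
    have hnl : rad (fun a k t => ((f a).block ⟨i, hi⟩).layer.eval
        (((f a).block ⟨i, hi⟩).ssm.ioMap ((f a).hidden (u k) i) t))
        ≤ (P.cls i).mu (P.gain i * P.radius i) * (P.gain i * (P.radBound i * √N))
          + (P.cls i).c (P.gain i * P.radius i) * √N := by
      rw [rad_pi]
      refine (LayerClass.rad_eval_le (hc.valid ⟨i, hi⟩) hr
        (fun p : (Σ _ : ι, Fin T) => ((f p.1).block ⟨i, hi⟩).layer)
        (fun p => (hf p.1).admits ⟨i, hi⟩)
        (fun p k => ((f p.1).block ⟨i, hi⟩).ssm.ioMap ((f p.1).hidden (u k) i) p.2)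
        fun p k => (norm_le_pi_norm _ p.2).trans ((hf p.1).norm_ioMap_hidden_le (hu k) hi
          ((hf p.1).norm_hidden_le hT (hu k) (Nat.le_of_lt hi)))).trans ?_
      gcongr
      rw [rad_pi] at hio
      exact hio
    have hres := rad_smul_le (fun a k => (f a).hidden (u k) i) (P.res i)
    have e : (fun a k => (f a).hidden (u k) (i + 1))
        = fun a (k : Fin N) => (fun t => ((f a).block ⟨i, hi⟩).layer.eval
            (((f a).block ⟨i, hi⟩).ssm.ioMap ((f a).hidden (u k) i) t))
          + P.res i • (f a).hidden (u k) i := by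
      funext a k
      rw [(f a).hidden_succ (u k) hi, (hf a).res_eq]
      rfl
    rw [e]
    refine (rad_add_le _ fun a k => P.res i • (f a).hidden (u k) i).trans ?_
    calc _ ≤ ((P.cls i).mu (P.gain i * P.radius i) * (P.gain i * (P.radBound i * √N))
          + (P.cls i).c (P.gain i * P.radius i) * √N) + |P.res i| * (P.radBound i * √N) :=
          add_le_add hnl (hres.trans (by gcongr))
      _ = P.radBound (i + 1) * √N := by
          rw [BoundData.radBound, BoundData.factor]
          ring

theorem rad_eval_le [Finite ι] (hT : 0 < T) (hf : ∀ a, (f a).Conforms P) [Nonempty ι] (hKu : 0 ≤ P.Ku)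
    (hu : ∀ k, (u k).l2Norm ≤ P.Ku) :
    rad (fun a k => (f a).eval (u k) 0) ≤ (P.mu * P.Ku + P.c) * √N := by
  have hc := hf (Classical.arbitrary ι)
  rw [← BoundData.KDec_mul_radBound, mul_assoc]
  refine (rad_le_mul_rad _ (fun a k => (f a).hidden (u k) P.L) hc.KDec_nonneg
    fun s a => ⟨a, ?_⟩).trans (mul_le_mul_of_nonneg_left (rad_hidden_le hT hf hKu hu le_rfl)
      hc.KDec_nonneg)
  have e : ∑ k, s k • (f a).eval (u k) 0
      = (f a).dec.mulVec (pool (∑ k, s k • (f a).hidden (u k) P.L)) 0 := by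
    rw [← pool_sum_smul, ← mulVec_sum_smul, Finset.sum_apply]
    rfl
  rw [e]
  refine (norm_le_pi_norm _ 0).trans ((norm_mulVec_le _ _).trans ?_)
  exact mul_le_mul (hf a).dec_lt.le (norm_pool_le _) (norm_nonneg _) hc.KDec_nonneg

end DeepSSM

/-! ### Uniform deviations over a finite class -/

section McDiarmid

variable {Z : Type*} [MeasurableSpace Z] (μ : Measure Z) [IsProbabilityMeasure μ]

lemma integrable_of_abs_le {Ω : Type*} [MeasurableSpace Ω] (ν : Measure Ω) [IsFiniteMeasure ν]
    {f : Ω → ℝ} (hf : Measurable f) {B : ℝ} (hB : ∀ x, |f x| ≤ B) : Integrable f ν :=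
  .of_bound hf.aestronglyMeasurable B (.of_forall hB)

lemma abs_integral_le {f : Z → ℝ} {B : ℝ} (hB : ∀ z, |f z| ≤ B) : |∫ z, f z ∂μ| ≤ B := by
  have h := norm_integral_le_of_norm_le_const (μ := μ) (f := f) (C := B) (.of_forall hB)
  simpa using h

/-- Exponential moments of a function of independent variables with bounded differences,
by integrating out one variable after the other with Hoeffding's lemma. -/
lemma integral_exp_le_of_bounded_differences {n : ℕ} {φ : (Fin n → Z) → ℝ} (hφ : Measurable φ)
    {B c : ℝ} (hB : ∀ S, |φ S| ≤ B)
    (hc : ∀ k (S S' : Fin n → Z), (∀ j ≠ k, S j = S' j) → |φ S - φ S'| ≤ c) (t : ℝ) :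
    ∫ S, Real.exp (t * (φ S - ∫ S', φ S' ∂Measure.pi fun _ => μ)) ∂(Measure.pi fun _ => μ)
      ≤ Real.exp (n * c ^ 2 * t ^ 2 / 2) := by
  have hZ : Nonempty Z := nonempty_of_isProbabilityMeasure μ
  induction n with
  | zero =>
    have h : ∀ S, φ S = φ ![] := fun S => congrArg φ (Subsingleton.elim _ _)
    simp [h]
  | succ n ih =>
    let ν : Measure (Fin n → Z) := Measure.pi fun _ => μ
    let e := (MeasurableEquiv.piFinSuccAbove (fun _ : Fin (n + 1) => Z) 0).symm
    have he : MeasurePreserving e (μ.prod ν) (Measure.pi fun _ => μ) :=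
      (measurePreserving_piFinSuccAbove (fun _ : Fin (n + 1) => μ) 0).symm
    have hcons : ∀ p : Z × (Fin n → Z), e p = Fin.cons p.1 p.2 := fun p => by
      simp [e, MeasurableEquiv.piFinSuccAbove_symm_apply, Fin.insertNthEquiv]
    have hint : ∀ f : (Fin (n + 1) → Z) → ℝ, ∫ S, f S ∂(Measure.pi fun _ => μ)
        = ∫ p, f (Fin.cons p.1 p.2) ∂(μ.prod ν) := fun f => by
      rw [← he.integral_comp']
      simp only [hcons]
    let φ' : Z × (Fin n → Z) → ℝ := fun p => φ (Fin.cons p.1 p.2)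
    have hφ' : Measurable φ' := by
      have := hφ.comp e.measurable
      simpa only [Function.comp_def, hcons] using this
    let ψ : (Fin n → Z) → ℝ := fun S => ∫ z, φ' (z, S) ∂μ
    have hψ : Measurable ψ := (hφ'.stronglyMeasurable.integral_prod_left').measurable
    have hsl : ∀ S, Measurable fun z => φ' (z, S) := fun S => hφ'.comp measurable_prodMk_right
    have hsi : ∀ S, Integrable (fun z => φ' (z, S)) μ := fun S =>
      integrable_of_abs_le μ (hsl S) fun z => hB _
    have hψB : ∀ S, |ψ S| ≤ B := fun S => abs_integral_le μ fun z => hB _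
    have hψc : ∀ k (S S' : Fin n → Z), (∀ j ≠ k, S j = S' j) → |ψ S - ψ S'| ≤ c := by
      intro k S S' hS
      have := norm_integral_le_of_norm_le_const (μ := μ) (f := fun z => φ' (z, S) - φ' (z, S'))
        (C := c) (.of_forall fun z => hc k.succ _ _ fun j hj => by
          refine Fin.cases (fun _ => rfl) (fun j hj => ?_) j hj
          simpa using hS j fun h => hj (by rw [h]))
      rw [integral_sub (hsi S) (hsi S')] at this
      simpa using this
    have hm : ∫ p, φ' p ∂(μ.prod ν) = ∫ S, ψ S ∂ν :=
      integral_prod_symm _ (integrable_of_abs_le _ hφ' fun p => hB _)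
    have hexp : ∀ {Ω : Type _} [MeasurableSpace Ω] (f : Ω → ℝ) (a : ℝ), (∀ x, |f x| ≤ B) →
        ∀ x, |Real.exp (t * (f x - a))| ≤ Real.exp (|t| * (B + |a|)) := by
      intro Ω _ f a hf x
      rw [abs_of_pos (Real.exp_pos _)]
      refine Real.exp_le_exp.2 ((le_abs_self _).trans ?_)
      rw [abs_mul]
      gcongr
      exact (abs_sub _ _).trans (by gcongr; exact hf x)
    rw [hint, hint, hm]
    have hI : Integrable (fun p : Z × (Fin n → Z) =>
        Real.exp (t * (φ (Fin.cons p.1 p.2) - ∫ S, ψ S ∂ν))) (μ.prod ν) :=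
      integrable_of_abs_le _ ((hφ'.sub_const _).const_mul t).exp
        (hexp φ' _ fun p => hB _)
    rw [integral_prod_symm _ hI]
    have hin : ∀ S, ∫ z, Real.exp (t * (φ (Fin.cons z S) - ∫ S, ψ S ∂ν)) ∂μ
        ≤ Real.exp (c ^ 2 * t ^ 2 / 2) * Real.exp (t * (ψ S - ∫ S, ψ S ∂ν)) := by
      intro S
      obtain ⟨z₀⟩ := hZ
      have hsub := hasSubgaussianMGF_of_mem_Icc (μ := μ) (X := fun z => φ' (z, S))
        (a := φ' (z₀, S) - c) (b := φ' (z₀, S) + c) (hsl S).aemeasurable (.of_forall fun z => by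
          have := hc 0 (Fin.cons z S) (Fin.cons z₀ S) fun j hj => by
            refine Fin.cases (fun h => absurd rfl h) (fun j _ => by simp) j hj
          rw [abs_le] at this
          exact ⟨by simp only [φ']; linarith, by simp only [φ']; linarith⟩)
      have h := hsub.mgf_le t
      have hcc : ((‖φ' (z₀, S) + c - (φ' (z₀, S) - c)‖₊ / 2) ^ 2 : NNReal) = c ^ 2 := by
        push_cast
        rw [show φ' (z₀, S) + c - (φ' (z₀, S) - c) = 2 * c by ring, norm_mul, Real.norm_ofNat,
          mul_div_cancel_left₀ _ two_ne_zero, Real.norm_eq_abs, sq_abs]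
      rw [hcc] at h
      calc ∫ z, Real.exp (t * (φ (Fin.cons z S) - ∫ S, ψ S ∂ν)) ∂μ
          = ∫ z, Real.exp (t * (φ' (z, S) - ψ S)) * Real.exp (t * (ψ S - ∫ S, ψ S ∂ν)) ∂μ := by
            congr 1
            funext z
            rw [← Real.exp_add]
            congr 1
            simp only [φ']
            ring
        _ = (∫ z, Real.exp (t * (φ' (z, S) - ψ S)) ∂μ)
              * Real.exp (t * (ψ S - ∫ S, ψ S ∂ν)) := integral_mul_const _ _
        _ ≤ _ := mul_le_mul_of_nonneg_right h (Real.exp_pos _).le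
    calc _ ≤ ∫ S, Real.exp (c ^ 2 * t ^ 2 / 2) * Real.exp (t * (ψ S - ∫ S, ψ S ∂ν)) ∂ν := by
          refine integral_mono hI.integral_prod_right ?_ hin
          exact (integrable_of_abs_le _ ((hψ.sub_const _).const_mul t).exp
            (hexp ψ _ hψB)).const_mul _
      _ = Real.exp (c ^ 2 * t ^ 2 / 2) * ∫ S, Real.exp (t * (ψ S - ∫ S, ψ S ∂ν)) ∂ν :=
          integral_const_mul _ _
      _ ≤ Real.exp (c ^ 2 * t ^ 2 / 2) * Real.exp (n * c ^ 2 * t ^ 2 / 2) := by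
          gcongr
          exact ih hψ hψB hψc
      _ = _ := by
          rw [← Real.exp_add]
          congr 1
          push_cast
          ring

/-- **McDiarmid's inequality**, with a constant that is not optimal. -/
theorem measureReal_ge_le_of_bounded_differences {n : ℕ} {φ : (Fin n → Z) → ℝ}
    (hφ : Measurable φ) {B c : ℝ} (hB : ∀ S, |φ S| ≤ B)
    (hc : ∀ k (S S' : Fin n → Z), (∀ j ≠ k, S j = S' j) → |φ S - φ S'| ≤ c) {ε : ℝ}
    (hε : 0 ≤ ε) :
    (Measure.pi fun _ : Fin n => μ).real {S | ε ≤ φ S - ∫ S', φ S' ∂Measure.pi fun _ => μ}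
      ≤ Real.exp (-ε ^ 2 / (2 * (n * c ^ 2))) := by
  have h : HasSubgaussianMGF (fun S => φ S - ∫ S', φ S' ∂Measure.pi fun _ => μ)
      (n * ⟨c ^ 2, sq_nonneg c⟩) (Measure.pi fun _ : Fin n => μ) := by
    refine ⟨fun t => ?_, fun t => ?_⟩
    · refine integrable_of_abs_le (B := Real.exp (|t| * (B + |∫ S', φ S' ∂Measure.pi fun _ => μ|)))
        _ ((hφ.sub_const _).const_mul t).exp fun S => ?_
      rw [abs_of_pos (Real.exp_pos _)]
      refine Real.exp_le_exp.2 ((le_abs_self _).trans ?_)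
      rw [abs_mul]
      gcongr
      exact (abs_sub _ _).trans (by gcongr; exact hB S)
    · exact integral_exp_le_of_bounded_differences μ hφ hB hc t
  exact h.measure_ge_le hε

end McDiarmid

section Symmetrization

variable {Z : Type*} [MeasurableSpace Z] (μ : Measure Z) [IsProbabilityMeasure μ]
  {ι : Type*} [Finite ι] {n : ℕ} {g : ι → Z → ℝ} {K : ℝ}

lemma abs_iSup_le_of_abs_le [Nonempty ι] {f : ι → ℝ} {B : ℝ} (h : ∀ i, |f i| ≤ B) : |⨆ i, f i| ≤ B :=
  abs_le.2 ⟨((abs_le.1 (h (Classical.arbitrary ι))).1).trans (le_iSup_finite f _),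
    ciSup_le fun i => (abs_le.1 (h i)).2⟩

lemma abs_sum_le_card_mul {f : Fin n → ℝ} {B : ℝ} (h : ∀ k, |f k| ≤ B) : |∑ k, f k| ≤ n * B := by
  refine (Finset.abs_sum_le_sum_abs _ _).trans ((Finset.sum_le_sum fun k _ => h k).trans ?_)
  simp

lemma integral_eval (f : Z → ℝ) (hf : Measurable f) (k : Fin n) :
    ∫ S, f (S k) ∂(Measure.pi fun _ : Fin n => μ) = ∫ z, f z ∂μ := by
  have h := measurePreserving_eval (fun _ : Fin n => μ) k
  have h2 := integral_map (μ := Measure.pi fun _ : Fin n => μ) h.measurable.aemeasurable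
    (f := f) hf.aestronglyMeasurable
  rw [h.map_eq] at h2
  exact h2.symm

/-- Exchanging the `k`-th points of two independent samples whenever `s k = -1` does not change
their joint distribution. -/
lemma integral_iSup_sign_sub (hg : ∀ i, Measurable (g i)) {s : Fin n → ℝ} (hs : IsSignVec s) :
    ∫ p : (Fin n → Z) × (Fin n → Z), (⨆ i, ∑ k, s k * (g i (p.2 k) - g i (p.1 k)))
        ∂((Measure.pi fun _ => μ).prod (Measure.pi fun _ => μ))
      = ∫ p : (Fin n → Z) × (Fin n → Z), (⨆ i, ∑ k, (g i (p.2 k) - g i (p.1 k)))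
        ∂((Measure.pi fun _ => μ).prod (Measure.pi fun _ => μ)) := by
  classical
  have he := measurePreserving_arrowProdEquivProdArrow Z Z (Fin n) (fun _ => μ) fun _ => μ
  let τ : Fin n → Z × Z → Z × Z := fun k => if s k = 1 then id else Prod.swap
  have hτ : MeasurePreserving (fun w k => τ k (w k)) (Measure.pi fun _ : Fin n => μ.prod μ)
      (Measure.pi fun _ : Fin n => μ.prod μ) := by
    refine measurePreserving_pi _ _ fun k => ?_
    simp only [τ]
    split_ifs
    · exact MeasurePreserving.id _
    · exact Measure.measurePreserving_swap
  rw [← he.integral_comp', ← he.integral_comp']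
  have hm : Measurable fun w : Fin n → Z × Z => ⨆ i, ∑ k, (g i (w k).2 - g i (w k).1) := by
    refine Measurable.iSup fun i => Finset.measurable_sum _ fun k _ => ?_
    exact ((hg i).comp (measurable_snd.comp (measurable_pi_apply k))).sub
      ((hg i).comp (measurable_fst.comp (measurable_pi_apply k)))
  have h2 := integral_map (μ := Measure.pi fun _ : Fin n => μ.prod μ)
    hτ.measurable.aemeasurable hm.aestronglyMeasurable
  rw [hτ.map_eq] at h2
  refine Eq.trans ?_ h2.symm
  congr 1
  funext w
  refine iSup_congr fun i => Finset.sum_congr rfl fun k _ => ?_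
  change s k * (g i (w k).2 - g i (w k).1) = g i (τ k (w k)).2 - g i (τ k (w k)).1
  rcases hs k with h | h
  · simp [τ, h]
  · have h1 : ¬ s k = 1 := by rw [h]; norm_num
    simp only [τ, if_neg h1, Prod.snd_swap, Prod.fst_swap]
    rw [h]
    ring

/-- **Symmetrization**: the expected uniform deviation is at most twice the Rademacher
average. -/
theorem integral_iSup_deviation_le [Nonempty ι] (hg : ∀ i, Measurable (g i)) (hK : ∀ i z, |g i z| ≤ K) {R : ℝ}
    (hR : ∀ᵐ S ∂(Measure.pi fun _ : Fin n => μ),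
      signAvg n (fun s => ⨆ i, ∑ k, s k * g i (S k)) ≤ R) :
    ∫ S, (⨆ i, ∑ k, (∫ z, g i z ∂μ - g i (S k))) ∂(Measure.pi fun _ : Fin n => μ) ≤ 2 * R := by
  let ν : Measure (Fin n → Z) := Measure.pi fun _ => μ
  let H : (Fin n → ℝ) → (Fin n → Z) → ℝ := fun s S => ⨆ i, ∑ k, s k * g i (S k)
  let G : (Fin n → ℝ) → (Fin n → Z) × (Fin n → Z) → ℝ := fun s p =>
    ⨆ i, ∑ k, s k * (g i (p.2 k) - g i (p.1 k))
  have hgk : ∀ i (k : Fin n), Measurable fun S : Fin n → Z => g i (S k) := fun i k =>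
    (hg i).comp (measurable_pi_apply k)
  have hHm : ∀ s, Measurable (H s) := fun s =>
    Measurable.iSup fun i => Finset.measurable_sum _ fun k _ => (hgk i k).const_mul _
  have hGm : ∀ s, Measurable (G s) := fun s =>
    Measurable.iSup fun i => Finset.measurable_sum _ fun k _ =>
      (((hgk i k).comp measurable_snd).sub ((hgk i k).comp measurable_fst)).const_mul _
  have hs1 : ∀ {s : Fin n → ℝ}, IsSignVec s → ∀ k, |s k| = 1 := fun hs k => by
    rcases hs k with h | h <;> simp [h]
  have hgg : ∀ i z z', |g i z' - g i z| ≤ 2 * K := fun i z z' =>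
    (abs_sub _ _).trans (by linarith [hK i z, hK i z'])
  have hHb : ∀ {s : Fin n → ℝ}, IsSignVec s → ∀ S, |H s S| ≤ n * K := fun hs S =>
    abs_iSup_le_of_abs_le fun i => abs_sum_le_card_mul fun k => by
      rw [abs_mul, hs1 hs, one_mul]
      exact hK i _
  have hGb : ∀ {s : Fin n → ℝ}, IsSignVec s → ∀ p, |G s p| ≤ n * (2 * K) := fun hs p =>
    abs_iSup_le_of_abs_le fun i => abs_sum_le_card_mul fun k => by
      rw [abs_mul, hs1 hs, one_mul]
      exact hgg i _ _
  have hHi : ∀ {s : Fin n → ℝ}, IsSignVec s → Integrable (H s) ν := fun hs =>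
    integrable_of_abs_le ν (hHm _) (hHb hs)
  have hGi : ∀ {s : Fin n → ℝ}, IsSignVec s → Integrable (G s) (ν.prod ν) := fun hs =>
    integrable_of_abs_le _ (hGm _) (hGb hs)
  have h1 : IsSignVec (fun _ : Fin n => (1 : ℝ)) := fun k => Or.inl rfl
  have hneg : ∀ {s : Fin n → ℝ}, IsSignVec s → IsSignVec (-s) := fun hs k => by
    rcases hs k with h | h <;> simp [h]
  -- an independent second sample replaces the expectation, by Jensen's inequality
  have hA : ∫ S, (⨆ i, ∑ k, (∫ z, g i z ∂μ - g i (S k))) ∂ν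
      ≤ ∫ p, G (fun _ => 1) p ∂(ν.prod ν) := by
    rw [integral_prod _ (hGi h1)]
    refine integral_mono ?_ (hGi h1).integral_prod_left fun S => ?_
    · refine integrable_of_abs_le (B := n * (2 * K)) ν (Measurable.iSup fun i =>
        Finset.measurable_sum _ fun k _ => (hgk i k).const_sub _) fun S =>
        abs_iSup_le_of_abs_le fun i => abs_sum_le_card_mul fun k => ?_
      have hb := abs_integral_le μ (hK i)
      exact (abs_sub _ _).trans (by linarith [hK i (S k)])
    · have hgi : ∀ i (k : Fin n), Integrable (fun S' : Fin n → Z => g i (S' k)) ν := fun i k =>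
        integrable_of_abs_le ν (hgk i k) fun S' => hK i _
      refine ciSup_le fun i => ?_
      have e : ∑ k, (∫ z, g i z ∂μ - g i (S k))
          = ∫ S', ∑ k, 1 * (g i (S' k) - g i (S k)) ∂ν := by
        simp only [one_mul]
        rw [integral_finsetSum _ fun k _ => show Integrable (fun S' : Fin n → Z =>
          g i (S' k) - g i (S k)) ν from (hgi i k).sub (integrable_const _)]
        refine Finset.sum_congr rfl fun k _ => ?_
        rw [integral_sub (hgi i k) (integrable_const _), integral_eval μ (g i) (hg i) k]
        simp
      rw [e]
      refine integral_mono ?_ ?_ fun S' =>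
        le_iSup_finite (fun i => ∑ k, 1 * (g i (S' k) - g i (S k))) i
      · exact integrable_finsetSum _ fun k _ => ((hgi i k).sub (integrable_const _)).const_mul _
      · exact integrable_of_abs_le ν ((hGm _).comp measurable_prodMk_left) fun S' => hGb h1 (S, S')
  have hB : ∀ s, IsSignVec s → ∫ p, G (fun _ => 1) p ∂(ν.prod ν)
      ≤ ∫ S, H s S ∂ν + ∫ S, H (-s) S ∂ν := by
    intro s hs
    have e : ∫ p, G (fun _ => 1) p ∂(ν.prod ν) = ∫ p, G s p ∂(ν.prod ν) := by
      simp only [G, one_mul]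
      exact (integral_iSup_sign_sub μ hg hs).symm
    have e1 : ∫ p : (Fin n → Z) × (Fin n → Z), H s p.2 ∂(ν.prod ν) = ∫ S, H s S ∂ν := by
      simpa using integral_fun_snd (μ := ν) (ν := ν) (H s)
    have e2 : ∫ p : (Fin n → Z) × (Fin n → Z), H (-s) p.1 ∂(ν.prod ν) = ∫ S, H (-s) S ∂ν := by
      simpa using integral_fun_fst (μ := ν) (ν := ν) (H (-s))
    have i1 : Integrable (fun p : (Fin n → Z) × (Fin n → Z) => H s p.2) (ν.prod ν) :=
      integrable_of_abs_le _ ((hHm s).comp measurable_snd) fun p => hHb hs p.2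
    have i2 : Integrable (fun p : (Fin n → Z) × (Fin n → Z) => H (-s) p.1) (ν.prod ν) :=
      integrable_of_abs_le _ ((hHm (-s)).comp measurable_fst) fun p => hHb (hneg hs) p.1
    rw [e, ← e1, ← e2, ← integral_add i1 i2]
    refine integral_mono (hGi hs) (i1.add i2) fun p => ciSup_le fun i => ?_
    have h3 := le_iSup_finite (fun i => ∑ k, s k * g i (p.2 k)) i
    have h4 := le_iSup_finite (fun i => ∑ k, (-s) k * g i (p.1 k)) i
    refine le_trans (le_of_eq ?_) (add_le_add h3 h4)
    rw [← Finset.sum_add_distrib]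
    refine Finset.sum_congr rfl fun k _ => ?_
    simp only [Pi.neg_apply]
    ring
  have hC : signAvg n (fun s => ∫ S, H s S ∂ν) = ∫ S, signAvg n (fun s => H s S) ∂ν := by
    simp only [signAvg]
    rw [integral_const_mul, integral_finsetSum _ fun σ _ => hHi (isSignVec_signVec σ)]
  have hSi : Integrable (fun S => signAvg n (fun s => H s S)) ν := by
    simp only [signAvg]
    exact (integrable_finsetSum _ fun σ _ => hHi (isSignVec_signVec σ)).const_mul _
  refine hA.trans ?_
  rw [← signAvg_const n (∫ p, G (fun _ => 1) p ∂(ν.prod ν))]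
  refine (signAvg_mono hB).trans ?_
  rw [signAvg_add, signAvg_neg fun s => ∫ S, H s S ∂ν, ← two_mul, hC]
  refine mul_le_mul_of_nonneg_left ?_ zero_le_two
  refine (integral_mono_ae hSi (integrable_const R) hR).trans (le_of_eq ?_)
  simp

/-- The generalization bound for a finite class of functions with values in `[0, K]`. -/
theorem measureReal_exists_deviation_le [Nonempty ι] (hn : 0 < n) (hg : ∀ i, Measurable (g i)) (hK₀ : 0 < K)
    (hK : ∀ i z, g i z ∈ Set.Icc 0 K) {R : ℝ}
    (hR : ∀ᵐ S ∂(Measure.pi fun _ : Fin n => μ),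
      signAvg n (fun s => ⨆ i, ∑ k, s k * g i (S k)) ≤ R)
    {δ : ℝ} (hδ₀ : 0 < δ) (hδ₁ : δ < 1) :
    (Measure.pi fun _ : Fin n => μ).real {S | ∃ i, 2 * R / n + K * √(2 * Real.log (4 / δ) / n)
      < ∫ z, g i z ∂μ - (n : ℝ)⁻¹ * ∑ k, g i (S k)} ≤ δ / 4 := by
  have hn' : (0 : ℝ) < n := by exact_mod_cast hn
  have hlog : 0 < Real.log (4 / δ) := Real.log_pos (by rw [lt_div_iff₀ hδ₀]; linarith)
  have habs : ∀ i z, |g i z| ≤ K := fun i z => abs_le.2 ⟨by linarith [(hK i z).1], (hK i z).2⟩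
  let φ : (Fin n → Z) → ℝ := fun S => ⨆ i, ∑ k, (∫ z, g i z ∂μ - g i (S k))
  have hφm : Measurable φ := Measurable.iSup fun i => Finset.measurable_sum _ fun k _ =>
    ((hg i).comp (measurable_pi_apply k)).const_sub _
  have hφb : ∀ S, |φ S| ≤ n * (2 * K) := fun S =>
    abs_iSup_le_of_abs_le fun i => abs_sum_le_card_mul fun k => by
      have hb := abs_integral_le μ (habs i)
      exact (abs_sub _ _).trans (by linarith [habs i (S k)])
  have hφ1 : ∀ k (S S' : Fin n → Z), (∀ j ≠ k, S j = S' j) → φ S ≤ φ S' + K := by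
    intro k S S' hS
    refine ciSup_le fun i => ?_
    have h := le_iSup_finite (fun i => ∑ k, (∫ z, g i z ∂μ - g i (S' k))) i
    have h2 : ∑ k, (∫ z, g i z ∂μ - g i (S k)) - ∑ k, (∫ z, g i z ∂μ - g i (S' k))
        = g i (S' k) - g i (S k) := by
      rw [← Finset.sum_sub_distrib, Finset.sum_eq_single k]
      · ring
      · intro j _ hj
        rw [hS j hj, sub_self]
      · simp
    have h3 := (hK i (S' k)).2
    have h4 := (hK i (S k)).1
    change _ ≤ φ S' at h
    linarith
  have hφc : ∀ k (S S' : Fin n → Z), (∀ j ≠ k, S j = S' j) → |φ S - φ S'| ≤ K := by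
    intro k S S' hS
    have h1 := hφ1 k S S' hS
    have h2 := hφ1 k S' S fun j hj => (hS j hj).symm
    rw [abs_le]
    constructor <;> linarith
  have hE := integral_iSup_deviation_le μ hg habs hR
  let ε : ℝ := n * (K * √(2 * Real.log (4 / δ) / n))
  have hε : 0 ≤ ε := by positivity
  have hM := measureReal_ge_le_of_bounded_differences μ hφm hφb hφc hε
  have hexp : Real.exp (-ε ^ 2 / (2 * (n * K ^ 2))) = δ / 4 := by
    have e : -ε ^ 2 / (2 * (n * K ^ 2)) = -Real.log (4 / δ) := by
      simp only [ε, mul_pow]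
      rw [Real.sq_sqrt (by positivity)]
      field_simp
    rw [e, Real.exp_neg, Real.exp_log (by positivity), inv_div]
  rw [hexp] at hM
  refine (measureReal_mono ?_).trans hM
  rintro S ⟨i, hi⟩
  have h := le_iSup_finite (fun i => ∑ k, (∫ z, g i z ∂μ - g i (S k))) i
  change _ ≤ φ S at h
  simp only [Finset.sum_sub_distrib, Finset.sum_const, Finset.card_univ, Fintype.card_fin,
    nsmul_eq_mul] at h
  have h2 := mul_lt_mul_of_pos_left hi hn'
  have e1 : (n : ℝ) * (2 * R / n + K * √(2 * Real.log (4 / δ) / n)) = 2 * R + ε := by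
    simp only [ε]
    field_simp
  have e2 : (n : ℝ) * (∫ z, g i z ∂μ - (n : ℝ)⁻¹ * ∑ k, g i (S k))
      = n * ∫ z, g i z ∂μ - ∑ k, g i (S k) := by
    field_simp
  rw [e1, e2] at h2
  have h3 : ∫ S', φ S' ∂(Measure.pi fun _ => μ) ≤ 2 * R := hE
  change ε ≤ φ S - _
  linarith

end Symmetrization

/-! ### The generalization bound -/

namespace IsLipschitzLoss

variable {loss : ℝ → ℝ → ℝ} {Lip : ℝ}

lemma pos (h : IsLipschitzLoss loss Lip) : 0 < Lip := by
  have h1 := h.lipschitz 0 1 0 0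
  have h2 : loss 0 0 = 0 := (h.eq_zero_iff 0 0).2 rfl
  have h3 : loss 0 1 ≠ 0 := fun e => zero_ne_one ((h.eq_zero_iff 0 1).1 e)
  have h4 := lt_of_le_of_ne (h.nonneg 0 1) h3.symm
  norm_num [h2] at h1
  linarith

lemma abs_sub_le (h : IsLipschitzLoss loss Lip) (a b y : ℝ) :
    |loss a y - loss b y| ≤ |Lip * a - Lip * b| := by
  have h1 := h.lipschitz a y b y
  have h2 := h.lipschitz b y a y
  rw [← mul_sub, abs_mul, abs_of_pos h.pos, abs_le]
  rw [abs_sub_comm b a] at h2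
  simp only [sub_self, abs_zero, add_zero] at h1 h2
  constructor <;> linarith

lemma le_mul_abs_add_abs (h : IsLipschitzLoss loss Lip) (a y : ℝ) :
    loss a y ≤ Lip * (|a| + |y|) := by
  have h1 := h.lipschitz a y 0 0
  rw [(h.eq_zero_iff 0 0).2 rfl] at h1
  simpa using h1

lemma continuous (h : IsLipschitzLoss loss Lip) : Continuous fun p : ℝ × ℝ => loss p.1 p.2 := by
  have hb : ∀ p q : ℝ × ℝ, loss p.1 p.2 - loss q.1 q.2 ≤ 2 * Lip * dist p q := fun p q => by
    refine (h.lipschitz _ _ _ _).trans ?_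
    have h1 : |p.1 - q.1| ≤ dist p q := by
      rw [← Real.dist_eq, Prod.dist_eq]
      exact le_max_left _ _
    have h2 : |p.2 - q.2| ≤ dist p q := by
      rw [← Real.dist_eq, Prod.dist_eq]
      exact le_max_right _ _
    have := mul_le_mul_of_nonneg_left (add_le_add h1 h2) h.pos.le
    linarith
  refine (LipschitzWith.of_dist_le_mul (K := ⟨2 * Lip, by linarith [h.pos]⟩)
    fun p q => ?_).continuous
  have h1 := hb p q
  have h2 := hb q p
  rw [dist_comm q p] at h2
  rw [Real.dist_eq, abs_le]
  constructor
  · change -(2 * Lip * dist p q) ≤ _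
    linarith
  · exact h1

end IsLipschitzLoss

namespace ModelAssumptions

variable {nin nu ny T N : ℕ} {P : BoundData} {F : Set (DeepSSM P.L nin nu ny 1)}
  {FEnc : Set (Matrix (Fin nu) (Fin nin) ℝ)} {FDec : Set (Matrix (Fin 1) (Fin nu) ℝ)}
  {E : Set (SSM nu ny)} {Fnl : Fin P.L → Set (NonlinearLayer ny nu)} {loss : ℝ → ℝ → ℝ}
  {𝒟 : Measure (TSeq T nin × ℝ)}

lemma conforms (hP : ModelAssumptions P F FEnc FDec E Fnl loss 𝒟)
    {f : DeepSSM P.L nin nu ny 1} (hf : f ∈ F) : f.Conforms P where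
  K1_nonneg := hP.K1_nonneg
  K2_nonneg := hP.K2_nonneg
  enc_lt := hP.enc_lt _ (hP.arch f hf).1
  dec_lt := hP.dec_lt _ (hP.arch f hf).2.1
  l1Norm_le i := hP.l1Norm_le _ ((hP.arch f hf).2.2 i).1
  h2Norm_le i := hP.h2Norm_le _ ((hP.arch f hf).2.2 i).1
  res_eq i := ((hP.arch f hf).2.2 i).2.2
  valid := hP.cls_valid
  admits i := hP.layers i _ ((hP.arch f hf).2.2 i).2.1

lemma Kl_pos (hP : ModelAssumptions P F FEnc FDec E Fnl loss 𝒟) : 0 < P.Kl :=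
  mul_pos (mul_pos two_pos hP.loss_lipschitz.pos) (lt_max_of_lt_right hP.Ky_pos)

lemma continuous_loss (hP : ModelAssumptions P F FEnc FDec E Fnl loss 𝒟)
    {f : DeepSSM P.L nin nu ny 1} (hf : f ∈ F) :
    Continuous fun z : TSeq T nin × ℝ => loss (f.eval z.1 0) z.2 :=
  hP.loss_lipschitz.continuous.comp
    (((hP.conforms hf).continuous_eval.comp continuous_fst).prodMk continuous_snd)

/-- `K_l` bounds the loss, because the models and the labels are bounded and `ℓ(0, 0) = 0`. -/
lemma loss_le_Kl (hP : ModelAssumptions P F FEnc FDec E Fnl loss 𝒟) (hT : 0 < T)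
    {f : DeepSSM P.L nin nu ny 1} (hf : f ∈ F) {z : TSeq T nin × ℝ}
    (hz : TSeq.l2Norm z.1 ≤ P.Ku ∧ |z.2| ≤ P.Ky) : loss (f.eval z.1 0) z.2 ≤ P.Kl := by
  refine (hP.loss_lipschitz.le_mul_abs_add_abs _ _).trans ?_
  have h1 := ((hP.conforms hf).abs_eval_le hT hz.1).trans (le_max_left _ P.Ky)
  have h2 := hz.2.trans (le_max_right (P.KDec * P.radius P.L) P.Ky)
  rw [BoundData.Kl]
  have := mul_le_mul_of_nonneg_left (add_le_add h1 h2) hP.loss_lipschitz.pos.le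
  linarith

/-- The contraction principle removes the loss. -/
lemma signAvg_iSup_loss_le (hP : ModelAssumptions P F FEnc FDec E Fnl loss 𝒟) (hT : 0 < T)
    {ι : Type*} [Finite ι] [Nonempty ι] {f : ι → DeepSSM P.L nin nu ny 1} (hf : ∀ a, f a ∈ F)
    {S : Fin N → TSeq T nin × ℝ} (hS : ∀ k, TSeq.l2Norm (S k).1 ≤ P.Ku) :
    signAvg N (fun s => ⨆ a, ∑ k, s k * loss ((f a).eval (S k).1 0) (S k).2)
      ≤ P.Lip * ((P.mu * P.Ku + P.c) * √N) := by
  have h := signAvg_iSup_le (fun _ : ι => 0) (fun a k => P.Lip * (f a).eval (S k).1 0)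
    (fun a (k : Fin N) => loss ((f a).eval (S k).1 0) (S k).2)
    fun k a b => hP.loss_lipschitz.abs_sub_le _ _ _
  simp only [zero_add] at h
  refine h.trans (le_trans ?_ (mul_le_mul_of_nonneg_left (DeepSSM.rad_eval_le hT
    (fun a => hP.conforms (hf a)) hP.Ku_pos.le hS) hP.loss_lipschitz.pos.le))
  rw [rad, ← signAvg_const_mul]
  refine signAvg_mono fun s _ => ciSup_le fun a => ?_
  have e : ∑ k, s k * (P.Lip * (f a).eval (S k).1 0)
      = P.Lip * ∑ k, s k • (f a).eval (S k).1 0 := by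
    rw [Finset.mul_sum]
    exact Finset.sum_congr rfl fun k _ => by rw [smul_eq_mul]; ring
  rw [e]
  exact mul_le_mul_of_nonneg_left ((le_abs_self _).trans
    (le_iSup_finite (fun a => ‖∑ k, s k • (f a).eval (S k).1 0‖) a)) hP.loss_lipschitz.pos.le

lemma isOpen_setOf_lt_deviation (hP : ModelAssumptions P F FEnc FDec E Fnl loss 𝒟)
    {f : DeepSSM P.L nin nu ny 1} (hf : f ∈ F) (t : ℝ) :
    IsOpen {S : Fin N → TSeq T nin × ℝ | t < trueLoss loss 𝒟 f - empLoss loss S f} := by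
  have h : Continuous fun S : Fin N → TSeq T nin × ℝ =>
      trueLoss loss 𝒟 f - empLoss loss S f := by
    unfold empLoss
    exact continuous_const.sub (continuous_const.mul (continuous_finsetSum _ fun k _ =>
      (hP.continuous_loss hf).comp (continuous_apply k)))
  exact isOpen_lt continuous_const h

variable [IsProbabilityMeasure 𝒟]

/-- For finite subfamilies all suprema are measurable. The loss is cut off at `K_l`, which
changes it only on a null set, to make it bounded everywhere. -/
lemma measureReal_exists_mem_finset_le (hP : ModelAssumptions P F FEnc FDec E Fnl loss 𝒟)
    (hT : 0 < T) (hN : 0 < N) {δ : ℝ} (hδ₀ : 0 < δ) (hδ₁ : δ < 1) (t : Finset F) :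
    (Measure.pi fun _ : Fin N => 𝒟).real {S | ∃ f ∈ t,
      2 * (P.mu * P.Ku * P.Lip + P.c * P.Lip) / √(N : ℝ) + P.Kl * √(2 * Real.log (4 / δ) / N)
        < trueLoss loss 𝒟 f.1 - empLoss loss S f.1} ≤ δ / 4 := by
  rcases t.eq_empty_or_nonempty with rfl | ht
  · simp
    linarith
  have : Nonempty t := ht.to_subtype
  have hN' : (0 : ℝ) < N := by exact_mod_cast hN
  let g : t → TSeq T nin × ℝ → ℝ := fun f z => min (loss (f.1.1.eval z.1 0) z.2) P.Kl
  have hS : ∀ᵐ S ∂(Measure.pi fun _ : Fin N => 𝒟),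
      ∀ k, TSeq.l2Norm (S k).1 ≤ P.Ku ∧ |(S k).2| ≤ P.Ky :=
    ae_all_iff.2 fun k =>
      (Measure.quasiMeasurePreserving_eval (fun _ : Fin N => 𝒟) k).ae hP.bounded_data
  have hgl : ∀ (f : t) (z : TSeq T nin × ℝ), TSeq.l2Norm z.1 ≤ P.Ku ∧ |z.2| ≤ P.Ky →
      g f z = loss (f.1.1.eval z.1 0) z.2 := fun f z hz =>
    min_eq_left (hP.loss_le_Kl hT f.1.2 hz)
  have hR : ∀ᵐ S ∂(Measure.pi fun _ : Fin N => 𝒟),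
      signAvg N (fun s => ⨆ f, ∑ k, s k * g f (S k))
        ≤ P.Lip * ((P.mu * P.Ku + P.c) * √N) := by
    filter_upwards [hS] with S hS
    simp only [fun f k => hgl f (S k) (hS k)]
    exact hP.signAvg_iSup_loss_le hT (fun f : t => f.1.2) fun k => (hS k).1
  have hmain := measureReal_exists_deviation_le 𝒟 hN
    (fun f => ((hP.continuous_loss f.1.2).min continuous_const).measurable) hP.Kl_pos
    (fun f z => ⟨le_min (hP.loss_lipschitz.nonneg _ _) hP.Kl_pos.le, min_le_right _ _⟩)
    hR hδ₀ hδ₁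
  refine le_trans (ENNReal.toReal_mono (measure_ne_top _ _) (measure_mono_ae ?_)) hmain
  filter_upwards [hS] with S hS
  rintro ⟨f, hf, h⟩
  refine ⟨⟨f, hf⟩, ?_⟩
  have e1 : ∫ z, g ⟨f, hf⟩ z ∂𝒟 = trueLoss loss 𝒟 f.1 := by
    refine integral_congr_ae ?_
    filter_upwards [hP.bounded_data] with z hz using hgl ⟨f, hf⟩ z hz
  have e2 : (N : ℝ)⁻¹ * ∑ k, g ⟨f, hf⟩ (S k) = empLoss loss S f.1 := by
    simp only [fun k => hgl ⟨f, hf⟩ (S k) (hS k), empLoss]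
  have e3 : 2 * (P.Lip * ((P.mu * P.Ku + P.c) * √N)) / N
      = 2 * (P.mu * P.Ku * P.Lip + P.c * P.Lip) / √(N : ℝ) := by
    have hq : √(N : ℝ) ≠ 0 := (Real.sqrt_pos.2 hN').ne'
    rw [div_eq_div_iff hN'.ne' hq]
    nth_rewrite 3 [← Real.mul_self_sqrt hN'.le]
    ring
  rw [e1, e2, e3]
  exact h

end ModelAssumptions

end

theorem theorem2 {nin nu ny T N : ℕ} (hT : 0 < T) (hN : 0 < N)
    (P : BoundData)
    (F : Set (DeepSSM P.L nin nu ny 1))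
    (FEnc : Set (Matrix (Fin nu) (Fin nin) ℝ)) (FDec : Set (Matrix (Fin 1) (Fin nu) ℝ))
    (E : Set (SSM nu ny)) (Fnl : Fin P.L → Set (NonlinearLayer ny nu))
    (loss : ℝ → ℝ → ℝ)
    (𝒟 : MeasureTheory.Measure (TSeq T nin × ℝ)) [MeasureTheory.IsProbabilityMeasure 𝒟]
    (hP : ModelAssumptions P F FEnc FDec E Fnl loss 𝒟)
    (δ : ℝ) (hδ₀ : 0 < δ) (hδ₁ : δ < 1) :
    MeasurableSet {S : Fin N → TSeq T nin × ℝ | ∀ f ∈ F,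
      trueLoss loss 𝒟 f - empLoss loss S f ≤
        2 * (P.mu * P.Ku * P.Lip + P.c * P.Lip) / √(N : ℝ)
          + P.Kl * √(2 * Real.log (4 / δ) / N)} ∧
    1 - δ < (MeasureTheory.Measure.pi fun _ : Fin N => 𝒟).real
      {S : Fin N → TSeq T nin × ℝ | ∀ f ∈ F,
        trueLoss loss 𝒟 f - empLoss loss S f ≤
          2 * (P.mu * P.Ku * P.Lip + P.c * P.Lip) / √(N : ℝ)
            + P.Kl * √(2 * Real.log (4 / δ) / N)} := by
  have hfin := hP.measureReal_exists_mem_finset_le hT hN hδ₀ hδ₁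
  set b := 2 * (P.mu * P.Ku * P.Lip + P.c * P.Lip) / √(N : ℝ)
    + P.Kl * √(2 * Real.log (4 / δ) / N)
  let U : F → Set (Fin N → TSeq T nin × ℝ) := fun f =>
    {S | b < trueLoss loss 𝒟 f.1 - empLoss loss S f.1}
  have hU : ∀ f, IsOpen (U f) := fun f => hP.isOpen_setOf_lt_deviation f.2 b
  have hcompl : {S : Fin N → TSeq T nin × ℝ | ∀ f ∈ F,
      trueLoss loss 𝒟 f - empLoss loss S f ≤ b} = (⋃ f, U f)ᶜ := by
    ext S
    simp [U]
  have hopen : IsOpen (⋃ f, U f) := isOpen_iUnion hU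
  rw [hcompl]
  refine ⟨hopen.measurableSet.compl, ?_⟩
  -- by second countability the exceptional set is a countable union, hence the increasing union
  -- of the exceptional sets of finite subfamilies
  obtain ⟨C, hC, hCU⟩ := TopologicalSpace.isOpen_iUnion_countable U hU
  have : Countable C := hC.to_subtype
  have hdir : Directed (· ⊆ ·) fun t : Finset C => ⋃ f ∈ t, U f.1 :=
    Monotone.directed_le fun s t hst => Set.biUnion_subset_biUnion_left hst
  have hunion : ⋃ f, U f = ⋃ t : Finset C, ⋃ f ∈ t, U f.1 := by
    rw [← hCU]
    ext S
    simp only [Set.mem_iUnion, exists_prop]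
    constructor
    · rintro ⟨f, hf, h⟩
      exact ⟨{⟨f, hf⟩}, ⟨f, hf⟩, Finset.mem_singleton_self _, h⟩
    · rintro ⟨t, f, -, h⟩
      exact ⟨f.1, f.2, h⟩
  have hbad : (MeasureTheory.Measure.pi fun _ : Fin N => 𝒟) (⋃ f, U f)
      ≤ ENNReal.ofReal (δ / 4) := by
    rw [hunion, hdir.measure_iUnion]
    refine iSup_le fun t => ?_
    have h := hfin (t.map (Function.Embedding.subtype _))
    rw [← MeasureTheory.ofReal_measureReal (h := MeasureTheory.measure_ne_top _ _)]
    refine ENNReal.ofReal_le_ofReal (le_trans (MeasureTheory.measureReal_mono ?_) h)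
    intro S hS
    simp only [Set.mem_iUnion, exists_prop] at hS
    obtain ⟨f, hf, h⟩ := hS
    exact ⟨f.1, Finset.mem_map_of_mem _ hf, h⟩
  rw [MeasureTheory.probReal_compl_eq_one_sub hopen.measurableSet]
  have h := ENNReal.toReal_mono ENNReal.ofReal_ne_top hbad
  rw [ENNReal.toReal_ofReal (by positivity)] at h
  rw [MeasureTheory.measureReal_def]
  linarith
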